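/- Let $\Gamma$ be a finite simple graph without isolated vertices, with $n$ vertices and $N$ edges. Orient each edge $e_j$ arbitrarily and identify it with $[0,1]$; for a vertex $v$ put $d_{vj}=1$ if $v$ is the end point of $e_j$ with parameter $1$, $d_{vj}=-1$ if $v$ is the end point with parameter $0$, and $d_{vj}=0$ otherwise. For $u=(u_j)_{j=1}^N\in C^2([0,1];\mathbb C)^N$ and $v\in e_j$ let $u_j(v)$ and $u_j'(v)$ be the values of $u_j$ and of its (one-sided) derivative at the parameter of $v$. Let $\Delta^{CK}$ and $\Delta^{KC}$ be the operators $(u_j)\mapsto(u_j'')$ whose domains consist of all $u\in C^2([0,1];\mathbb C)^N$ such that, for every vertex $v$, - ($CK$) $u_j(v)=u_k(v)$ for all edges $e_j,e_k$ incident with $v$, and $\sum_{j} d_{vj}\,u_j'(v)=0$; - ($KC$) $\sum_j d_{vj}^2\,u_j(v)=0$, and $d_{vj}\,u_j'(v)=d_{vk}\,u_k'(v)$ for all edges $e_j,e_k$ incident with $v$, respectively. The multiplicity of $\lambda$ is the dimension of $\{u : -\Delta u=\lambda u\}$. Two graphs are isospectral for $-\Delta^{CK}$ (respectively $-\Delta^{KC}$)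 if these operators have the same eigenvalues with the same multiplicities. (i) The eigenvalues with multiplicities of either $-\Delta^{CK}$ or $-\Delta^{KC}$ determine the number $n$ of vertices, the number $N$ of edges, the number $c$ of connected components, the numbers $c^+$ and $c^-$ of bipartite and of non-bipartite connected components, and hence whether the graph is bipartite. That is, if two finite simple graphs without isolated vertices are isospectral for $-\Delta^{CK}$ or isospectral for $-\Delta^{KC}$, then they agree in all these invariants. (ii) They do not determine the vertex degrees, whether the graph is regular, or the complexity (the number of spanning trees). Indeed, let $\Gamma_1$ be the circuit of length $8$, and $\Gamma_2$ the circuit of length $4$ with two paths of length $2$ glued, each by one of its end points, to one and the same vertex of the circuit. Then $\Gamma_1$ and $\Gamma_2$ are isospectral both for $-\Delta^{CK}$ and for $-\Delta^{KC}$, but their multisets of vertex degrees differ, $\Gamma_1$ is regular and $\Gamma_2$ is not, and their complexities are $8$ and $4$, respectively. -/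

import Mathlib

/-! Complex-valued functions on `[0,1]` and their (one-sided at the end points) derivatives. -/

namespace QGraph

open Set

noncomputable section

/-- `f : [0,1] → ℂ`, extended constantly outside `[0,1]`; only its values on `[0,1]` matter below. -/
def ext (f : unitInterval → ℂ) : ℝ → ℂ := IccExtend (zero_le_one : (0 : ℝ) ≤ 1) f

/-- First derivative of `f` on `[0,1]` (one-sided at `0` and `1`). -/
def d1 (f : unitInterval → ℂ) (x : unitInterval) : ℂ := derivWithin (ext f) (Icc 0 1) x

/-- Second derivative of `f` on `[0,1]` (one-sided at `0` and `1`). -/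
def d2 (f : unitInterval → ℂ) (x : unitInterval) : ℂ := iteratedDerivWithin 2 (ext f) (Icc 0 1) x

/-- `f ∈ C²[0,1]`. -/
def IsC2 (f : unitInterval → ℂ) : Prop := ContDiffOn ℝ 2 (ext f) (Icc 0 1)

theorem ext_add (f g : unitInterval → ℂ) : ext (f + g) = ext f + ext g := rfl

theorem ext_smul (a : ℂ) (f : unitInterval → ℂ) : ext (a • f) = a • ext f := rfl

theorem IsC2.zero : IsC2 0 := by
  have h : ext 0 = fun _ => 0 := rfl
  rw [IsC2, h]
  exact contDiffOn_const

theorem IsC2.add {f g : unitInterval → ℂ} (hf : IsC2 f) (hg : IsC2 g) : IsC2 (f + g) := by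
  rw [IsC2, ext_add]
  exact ContDiffOn.add hf hg

theorem IsC2.smul (a : ℂ) {f : unitInterval → ℂ} (hf : IsC2 f) : IsC2 (a • f) := by
  rw [IsC2, ext_smul]
  exact ContDiffOn.const_smul a hf

theorem d1_zero (x : unitInterval) : d1 0 x = 0 := by
  have h : ext 0 = fun _ => 0 := rfl
  rw [d1, h]
  simp

theorem d1_add {f g : unitInterval → ℂ} (hf : IsC2 f) (hg : IsC2 g) (x : unitInterval) :
    d1 (f + g) x = d1 f x + d1 g x := by
  rw [d1, ext_add]
  exact derivWithin_add (hf.differentiableOn (by norm_num) x x.2)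
    (hg.differentiableOn (by norm_num) x x.2)

theorem d1_smul (a : ℂ) {f : unitInterval → ℂ} (hf : IsC2 f) (x : unitInterval) :
    d1 (a • f) x = a * d1 f x := by
  rw [d1, ext_smul]
  exact derivWithin_const_smul a (hf.differentiableOn (by norm_num) x x.2)

theorem d2_add {f g : unitInterval → ℂ} (hf : IsC2 f) (hg : IsC2 g) (x : unitInterval) :
    d2 (f + g) x = d2 f x + d2 g x := by
  rw [d2, ext_add]
  exact iteratedDerivWithin_add x.2 (uniqueDiffOn_Icc zero_lt_one) (hf x x.2) (hg x x.2)

theorem d2_smul (a : ℂ) {f : unitInterval → ℂ} (hf : IsC2 f) (x : unitInterval) :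
    d2 (a • f) x = a * d2 f x := by
  rw [d2, ext_smul]
  exact iteratedDerivWithin_const_smul x.2 (uniqueDiffOn_Icc zero_lt_one) a (hf x x.2)

/-! Orientations, and the Laplacians on the associated network with edges of length `1`. -/

/-- An orientation of a simple graph: a parametrization of each edge by `[0,1]` is determined by
its end point `src e` (parameter `0`) and its end point `tgt e` (parameter `1`). -/
structure Orientation {V : Type*} (G : SimpleGraph V) where
  src : G.edgeSet → V
  tgt : G.edgeSet → V
  mk_eq : ∀ e, s(src e, tgt e) = (e : Sym2 V)

instance {V : Type*} (G : SimpleGraph V) : Nonempty (Orientation G) :=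
  ⟨{ src := fun e => (Quot.out (e : Sym2 V)).1
     tgt := fun e => (Quot.out (e : Sym2 V)).2
     mk_eq := fun e => Quot.out_eq (e : Sym2 V) }⟩

variable {V : Type*} [Fintype V] [DecidableEq V] {G : SimpleGraph V} [DecidableRel G.Adj]

/-- Entry of the signed incidence matrix: `1` at the end, `-1` at the origin of the edge. -/
def Orientation.inc (O : Orientation G) (v : V) (e : G.edgeSet) : ℂ :=
  if O.tgt e = v then 1 else if O.src e = v then -1 else 0

/-- The parameter in `[0,1]` of the vertex `v` on the edge `e`, for `v` incident with `e`. -/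
def Orientation.pos (O : Orientation G) (v : V) (e : G.edgeSet) : unitInterval :=
  if O.tgt e = v then 1 else 0

/-- `C²[0,1]^N` with the `CK` condition: continuity at each vertex, and the Kirchhoff flow
condition (the outer normal derivatives at each vertex sum to zero). -/
def domCK (O : Orientation G) : Submodule ℂ (G.edgeSet → unitInterval → ℂ) where
  carrier := {u | (∀ e, IsC2 (u e)) ∧
    (∀ (v : V) (e f : G.edgeSet), v ∈ (e : Sym2 V) → v ∈ (f : Sym2 V) →
      u e (O.pos v e) = u f (O.pos v f)) ∧
    ∀ v : V, ∑ e : G.edgeSet, O.inc v e * d1 (u e) (O.pos v e) = 0}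
  zero_mem' := ⟨fun _ => IsC2.zero, fun _ _ _ _ _ => rfl, fun v => by simp [d1_zero]⟩
  add_mem' := by
    rintro u w ⟨hu, hu1, hu2⟩ ⟨hw, hw1, hw2⟩
    refine ⟨fun e => (hu e).add (hw e), fun v e f he hf => ?_, fun v => ?_⟩
    · simp only [Pi.add_apply]
      rw [hu1 v e f he hf, hw1 v e f he hf]
    · simp only [Pi.add_apply, d1_add (hu _) (hw _), mul_add, Finset.sum_add_distrib, hu2, hw2,
        add_zero]
  smul_mem' := by
    rintro a u ⟨hu, hu1, hu2⟩
    refine ⟨fun e => (hu e).smul a, fun v e f he hf => ?_, fun v => ?_⟩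
    · simp only [Pi.smul_apply]
      rw [hu1 v e f he hf]
    · simp only [Pi.smul_apply, d1_smul a (hu _), mul_left_comm _ a, ← Finset.mul_sum, hu2,
        mul_zero]

/-- `C²[0,1]^N` with the `KC` (anti-Kirchhoff) condition: at each vertex the values along the
incident edges sum to zero, and the outer normal derivatives coincide. -/
def domKC (O : Orientation G) : Submodule ℂ (G.edgeSet → unitInterval → ℂ) where
  carrier := {u | (∀ e, IsC2 (u e)) ∧
    (∀ v : V, ∑ e : G.edgeSet, O.inc v e ^ 2 * u e (O.pos v e) = 0) ∧
    ∀ (v : V) (e f : G.edgeSet), v ∈ (e : Sym2 V) → v ∈ (f : Sym2 V) →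
      O.inc v e * d1 (u e) (O.pos v e) = O.inc v f * d1 (u f) (O.pos v f)}
  zero_mem' := ⟨fun _ => IsC2.zero, fun v => by simp, fun _ _ _ _ _ => by simp [d1_zero]⟩
  add_mem' := by
    rintro u w ⟨hu, hu1, hu2⟩ ⟨hw, hw1, hw2⟩
    refine ⟨fun e => (hu e).add (hw e), fun v => ?_, fun v e f he hf => ?_⟩
    · simp only [Pi.add_apply, mul_add, Finset.sum_add_distrib, hu1, hw1, add_zero]
    · simp only [Pi.add_apply, d1_add (hu _) (hw _), mul_add]
      rw [hu2 v e f he hf, hw2 v e f he hf]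
  smul_mem' := by
    rintro a u ⟨hu, hu1, hu2⟩
    refine ⟨fun e => (hu e).smul a, fun v => ?_, fun v e f he hf => ?_⟩
    · simp only [Pi.smul_apply, smul_eq_mul, mul_left_comm _ a, ← Finset.mul_sum, hu1, mul_zero]
    · simp only [Pi.smul_apply, d1_smul a (hu _), mul_left_comm _ a]
      rw [hu2 v e f he hf]

/-- The edgewise second derivative, as an operator whose domain consists of `C²` functions. -/
def secondDeriv (D : Submodule ℂ (G.edgeSet → unitInterval → ℂ))
    (hD : ∀ u ∈ D, ∀ e, IsC2 (u e)) :
    (G.edgeSet → unitInterval → ℂ) →ₗ.[ℂ] (G.edgeSet → unitInterval → ℂ) where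
  domain := D
  toFun :=
    { toFun := fun u e => d2 ((u : G.edgeSet → unitInterval → ℂ) e)
      map_add' := fun u w => by
        funext e x
        exact d2_add (hD u u.2 e) (hD w w.2 e) x
      map_smul' := fun a u => by
        funext e x
        exact d2_smul a (hD u u.2 e) x }

/-- The Laplacian `Δ^{CK}`. -/
def laplacianCK (O : Orientation G) :
    (G.edgeSet → unitInterval → ℂ) →ₗ.[ℂ] (G.edgeSet → unitInterval → ℂ) :=
  secondDeriv (domCK O) fun _ hu => hu.1

/-- The Laplacian `Δ^{KC}`. -/
def laplacianKC (O : Orientation G) :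
    (G.edgeSet → unitInterval → ℂ) →ₗ.[ℂ] (G.edgeSet → unitInterval → ℂ) :=
  secondDeriv (domKC O) fun _ hu => hu.1

end

section Spectrum

variable {E : Type*} [AddCommGroup E] [Module ℂ E]

/-- The space `{u ∈ dom L | -L u = μ u}`. -/
def eigenspaceNeg (L : E →ₗ.[ℂ] E) (μ : ℂ) : Submodule ℂ L.domain :=
  LinearMap.ker (-L.toFun - μ • L.domain.subtype)

/-- The multiplicity of `μ` as an eigenvalue of `-L` (`0` if `μ` is not an eigenvalue). -/
noncomputable def multNeg (L : E →ₗ.[ℂ] E) (μ : ℂ) : ℕ := Module.finrank ℂ (eigenspaceNeg L μ)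

/-- `-L` and `-L'` have the same eigenvalues with the same multiplicities. -/
def Isospectral {E' : Type*} [AddCommGroup E'] [Module ℂ E'] (L : E →ₗ.[ℂ] E)
    (L' : E' →ₗ.[ℂ] E') : Prop :=
  ∀ μ : ℂ, multNeg L μ = multNeg L' μ

end Spectrum

section Invariants

variable {V : Type*}

/-- Number of connected components. -/
noncomputable def numComp (G : SimpleGraph V) : ℕ := Nat.card G.ConnectedComponent

/-- Number of bipartite connected components. -/
noncomputable def numBipComp (G : SimpleGraph V) : ℕ :=
  Nat.card {C : G.ConnectedComponent // C.toSimpleGraph.IsBipartite}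

/-- Number of non-bipartite connected components. -/
noncomputable def numNonBipComp (G : SimpleGraph V) : ℕ :=
  Nat.card {C : G.ConnectedComponent // ¬ C.toSimpleGraph.IsBipartite}

/-- The complexity: number of spanning trees. -/
noncomputable def complexity (G : SimpleGraph V) : ℕ :=
  Nat.card {T : SimpleGraph V // T ≤ G ∧ T.IsTree}

/-- The multiset of vertex degrees. -/
def degrees [Fintype V] (G : SimpleGraph V) [DecidableRel G.Adj] : Multiset ℕ :=
  (Finset.univ : Finset V).val.map fun v => G.degree v

/-- The circuit `0-1-2-3-0` of length `4` with the two paths `0-4-5` and `0-6-7` of length `2`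
glued to the vertex `0`. -/
def squareWithTwoPaths : SimpleGraph (Fin 8) where
  Adj a b := s(a, b) ∈ ({s(0, 1), s(1, 2), s(2, 3), s(3, 0), s(0, 4), s(4, 5), s(0, 6), s(6, 7)} :
    Finset (Sym2 (Fin 8)))
  symm := ⟨fun a b h => by rwa [Sym2.eq_swap (a := b)]⟩
  loopless := ⟨by decide⟩

instance : DecidableRel squareWithTwoPaths.Adj := fun a b =>
  inferInstanceAs (Decidable (s(a, b) ∈ ({s(0, 1), s(1, 2), s(2, 3), s(3, 0), s(0, 4), s(4, 5),
    s(0, 6), s(6, 7)} : Finset (Sym2 (Fin 8)))))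

end Invariants

end QGraph

/-! Write `λ = ω²`. On each edge an eigenfunction is a combination of the two fundamental solutions
of `f'' = -ω² f`, so an eigenspace is a finite-dimensional space of data at vertices and edges. Put
`C = cos ω`, let `S` be the value at `1` of the sine solution, `A` the adjacency matrix, `D` the
degree matrix, and `k(l)` the dimension of `{φ | A φ = l D φ}` (`adjKer`).

For CK with `S ≠ 0` the vertex values determine the slopes, and the Kirchhoff condition becomes `A φ
= C D φ`, so the multiplicity is `k(C)`. If `S = 0`, then `C = ±1`, vertex values and slopes
decouple, and rank-nullity for the incidence matrix gives `N - n + 2 k(C)`. For KC, exchanging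
values and outer normal derivatives leads to the same linear algebra with `C` replaced by `-C`; only
`λ = 0` is exceptional, with multiplicity `N - n + k(-1)`.

Moreover `k(1) = c` and `k(-1) = c⁺` (locally constant and alternating functions), and `∑ k(l) = n`,
because `D^(-1/2) A D^(-1/2)` is Hermitian. The multiplicities at `0`, `π²` and `(2π)²` therefore
give `c`, `c⁺` and `N - n`, the others give `k(l)` for `l ≠ ±1`, and summation gives `n`.

Conversely `n`, `N` and the function `k` determine all multiplicities. For the two graphs on eight
vertices, an invertible matrix intertwining the transition matrices `D⁻¹A` shows that `k` agrees.
The complexities are counted by deleting one edge, as both graphs have as many edges as vertices. -/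

namespace QGraph

open Set

noncomputable section

set_option linter.unusedSectionVars false

/-! The solutions of `f'' = -ω² f` on `[0,1]`. -/

/-- The solution of `f'' = -ω² f` with `f 0 = 1`, `f' 0 = 0`. -/
def cosSol (ω : ℂ) (x : ℝ) : ℂ := Complex.cos (ω * x)

/-- The solution of `f'' = -ω² f` with `f 0 = 0`, `f' 0 = 1`. -/
def sinSol (ω : ℂ) (x : ℝ) : ℂ := if ω = 0 then (x : ℂ) else Complex.sin (ω * x) / ω

@[simp] theorem cosSol_zero (ω : ℂ) : cosSol ω 0 = 1 := by simp [cosSol]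

@[simp] theorem sinSol_zero (ω : ℂ) : sinSol ω 0 = 0 := by simp [sinSol]

/-- This is the Wronskian of the fundamental solutions. At `x = 1` it becomes the relation `C² + M S
= 1` on which the elimination of the slopes rests. -/
theorem cosSol_sq_add (ω : ℂ) (x : ℝ) : cosSol ω x ^ 2 + ω ^ 2 * sinSol ω x ^ 2 = 1 := by
  unfold cosSol sinSol
  split_ifs with h
  · simp [h]
  · rw [div_pow, mul_div_cancel₀ _ (pow_ne_zero 2 h), add_comm]
    exact Complex.sin_sq_add_cos_sq _

theorem hasDerivAt_mul_ofReal (ω : ℂ) (x : ℝ) : HasDerivAt (fun y : ℝ => ω * (y : ℂ)) ω x := by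
  simpa using (Complex.ofRealCLM.hasDerivAt (x := x)).const_mul ω

theorem hasDerivAt_cosSol (ω : ℂ) (x : ℝ) :
    HasDerivAt (cosSol ω) (-ω ^ 2 * sinSol ω x) x := by
  have h := (Complex.hasDerivAt_cos (ω * x)).comp x (hasDerivAt_mul_ofReal ω x)
  refine h.congr_deriv ?_
  unfold sinSol
  split_ifs with h0
  · simp [h0]
  · field_simp

theorem hasDerivAt_sinSol (ω : ℂ) (x : ℝ) : HasDerivAt (sinSol ω) (cosSol ω x) x := by
  by_cases h0 : ω = 0
  · have : sinSol ω = fun y : ℝ => (y : ℂ) := by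
      funext y
      simp [sinSol, h0]
    rw [this]
    refine (Complex.ofRealCLM.hasDerivAt (x := x)).congr_deriv ?_
    simp [cosSol, h0]
  · have h := ((Complex.hasDerivAt_sin (ω * x)).comp x (hasDerivAt_mul_ofReal ω x)).div_const ω
    have e : sinSol ω = fun y : ℝ => (Complex.sin ∘ fun y : ℝ => ω * (y : ℂ)) y / ω := by
      funext y
      simp [sinSol, h0]
    rw [e]
    refine h.congr_deriv ?_
    rw [cosSol, mul_div_cancel_right₀ _ h0]

theorem ext_coe (f : unitInterval → ℂ) (x : unitInterval) : ext f x = f x := by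
  simp [ext]

theorem d2_eq (f : unitInterval → ℂ) (x : unitInterval) :
    d2 f x = derivWithin (derivWithin (ext f) (Icc 0 1)) (Icc 0 1) x := by
  rw [d2, iteratedDerivWithin_succ, iteratedDerivWithin_one]

/-- The combination `a c + b s` of the fundamental solutions, on `[0,1]`. -/
def sol (ω a b : ℂ) (x : unitInterval) : ℂ := a * cosSol ω x + b * sinSol ω x

/-- The derivative of `sol`. -/
def solDeriv (ω a b : ℂ) (x : ℝ) : ℂ := a * (-ω ^ 2 * sinSol ω x) + b * cosSol ω x

theorem hasDerivAt_comb (ω a b : ℂ) (x : ℝ) :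
    HasDerivAt (fun y => a * cosSol ω y + b * sinSol ω y) (solDeriv ω a b x) x :=
  ((hasDerivAt_cosSol ω x).const_mul a).add ((hasDerivAt_sinSol ω x).const_mul b)

theorem hasDerivAt_solDeriv (ω a b : ℂ) (x : ℝ) :
    HasDerivAt (solDeriv ω a b) (-ω ^ 2 * (a * cosSol ω x + b * sinSol ω x)) x := by
  have h := (((hasDerivAt_sinSol ω x).const_mul (-ω ^ 2)).const_mul a).add
    ((hasDerivAt_cosSol ω x).const_mul b)
  refine h.congr_deriv ?_
  ring

theorem ext_sol_eqOn (ω a b : ℂ) :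
    EqOn (ext (sol ω a b)) (fun y => a * cosSol ω y + b * sinSol ω y) (Icc 0 1) :=
  fun x hx => ext_coe (sol ω a b) ⟨x, hx⟩

theorem isC2_sol (ω a b : ℂ) : IsC2 (sol ω a b) := by
  refine ContDiffOn.congr ?_ (ext_sol_eqOn ω a b)
  refine ContDiff.contDiffOn ?_
  have hd : deriv (fun y => a * cosSol ω y + b * sinSol ω y) = solDeriv ω a b :=
    funext fun x => (hasDerivAt_comb ω a b x).deriv
  have hd' : deriv (solDeriv ω a b) = fun x => -ω ^ 2 * (a * cosSol ω x + b * sinSol ω x) :=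
    funext fun x => (hasDerivAt_solDeriv ω a b x).deriv
  have h2 : ((2 : ℕ∞) : WithTop ℕ∞) = 1 + 1 := by norm_num
  have hdiff : Differentiable ℝ (fun y => a * cosSol ω y + b * sinSol ω y) :=
    fun x => (hasDerivAt_comb ω a b x).differentiableAt
  change ContDiff ℝ ((2 : ℕ∞) : WithTop ℕ∞) _
  rw [h2, contDiff_succ_iff_deriv]
  refine ⟨hdiff, by simp, ?_⟩
  rw [hd, contDiff_one_iff_deriv, hd']
  exact ⟨fun x => (hasDerivAt_solDeriv ω a b x).differentiableAt,
    hdiff.continuous.const_mul _⟩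

theorem derivWithin_ext_sol (ω a b : ℂ) {x : ℝ} (hx : x ∈ Icc (0 : ℝ) 1) :
    derivWithin (ext (sol ω a b)) (Icc 0 1) x = solDeriv ω a b x := by
  rw [derivWithin_congr (ext_sol_eqOn ω a b) (ext_sol_eqOn ω a b hx)]
  exact (hasDerivAt_comb ω a b x).hasDerivWithinAt.derivWithin
    (uniqueDiffOn_Icc zero_lt_one x hx)

theorem d1_sol (ω a b : ℂ) (x : unitInterval) : d1 (sol ω a b) x = solDeriv ω a b x :=
  derivWithin_ext_sol ω a b x.2

theorem d2_sol (ω a b : ℂ) (x : unitInterval) :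
    d2 (sol ω a b) x = -ω ^ 2 * sol ω a b x := by
  rw [d2_eq, derivWithin_congr (fun y hy => derivWithin_ext_sol ω a b hy)
    (derivWithin_ext_sol ω a b x.2)]
  exact (hasDerivAt_solDeriv ω a b x).hasDerivWithinAt.derivWithin
    (uniqueDiffOn_Icc zero_lt_one x x.2)

/-- Every `C²` solution of `f'' = -ω² f` on `[0,1]` is determined by its initial values. -/
theorem eq_sol_of_d2_eq {ω : ℂ} {f : unitInterval → ℂ} (hf : IsC2 f)
    (h : ∀ x, d2 f x = -ω ^ 2 * f x) : f = sol ω (f 0) (d1 f 0) := by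
  have hu := uniqueDiffOn_Icc (zero_lt_one : (0 : ℝ) < 1)
  set F := ext f with hF
  set F' := derivWithin F (Icc 0 1) with hF'
  have hFd : ∀ x ∈ Icc (0 : ℝ) 1, HasDerivWithinAt F (F' x) (Icc 0 1) x := fun x hx =>
    (hf.differentiableOn (by norm_num) x hx).hasDerivWithinAt
  have hF'd : ∀ x ∈ Icc (0 : ℝ) 1, HasDerivWithinAt F' (-ω ^ 2 * F x) (Icc 0 1) x := by
    intro x hx
    have hc : ContDiffOn ℝ 1 F' (Icc 0 1) := hf.derivWithin hu (by norm_num)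
    have hd := (hc.differentiableOn (by norm_num) x hx).hasDerivWithinAt
    have e := h ⟨x, hx⟩
    rw [d2_eq] at e
    rw [← ext_coe f ⟨x, hx⟩] at e
    exact e ▸ hd
  have key : ∀ g g' : ℝ → ℂ, (∀ x ∈ Icc (0 : ℝ) 1, HasDerivWithinAt g (g' x) (Icc 0 1) x) →
      (∀ x, g' x = 0) → ∀ x ∈ Icc (0 : ℝ) 1, g x = g 0 := by
    intro g g' hg h0
    refine constant_of_derivWithin_zero (fun x hx => (hg x hx).differentiableWithinAt) ?_
    intro x hx
    have hx' : x ∈ Icc (0 : ℝ) 1 := Ico_subset_Icc_self hx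
    rw [(hg x hx').derivWithin (hu x hx'), h0]
  -- Inverting the fundamental matrix expresses the initial data through `F` and `F'`. Both
  -- expressions have zero derivative, and the Wronskian identity then recovers `F`.
  have h1 := key (fun x => F x * cosSol ω x - F' x * sinSol ω x) _
    (fun x hx => ((hFd x hx).mul (hasDerivAt_cosSol ω x).hasDerivWithinAt).sub
      ((hF'd x hx).mul (hasDerivAt_sinSol ω x).hasDerivWithinAt)) (fun x => by ring)
  have h2 := key (fun x => F' x * cosSol ω x + ω ^ 2 * (F x * sinSol ω x)) _
    (fun x hx => ((hF'd x hx).mul (hasDerivAt_cosSol ω x).hasDerivWithinAt).add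
      (((hFd x hx).mul (hasDerivAt_sinSol ω x).hasDerivWithinAt).const_mul (ω ^ 2)))
      (fun x => by ring)
  funext x
  have e1 := h1 x x.2
  have e2 := h2 x x.2
  have f0 : F 0 = f 0 := ext_coe f 0
  have f0' : F' 0 = d1 f 0 := rfl
  have fx : F x = f x := ext_coe f x
  simp only [cosSol_zero, sinSol_zero, mul_one, mul_zero, sub_zero, add_zero, f0, f0', fx]
    at e1 e2
  rw [sol, ← e1, ← e2]
  linear_combination (-f x) * cosSol_sq_add ω x

@[simp] theorem sol_zero (ω a b : ℂ) : sol ω a b 0 = a := by simp [sol]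

@[simp] theorem sol_one (ω a b : ℂ) : sol ω a b 1 = a * cosSol ω 1 + b * sinSol ω 1 := by
  simp [sol]

@[simp] theorem d1_sol_zero (ω a b : ℂ) : d1 (sol ω a b) 0 = b := by simp [d1_sol, solDeriv]

@[simp] theorem d1_sol_one (ω a b : ℂ) :
    d1 (sol ω a b) 1 = -(ω ^ 2 * sinSol ω 1) * a + cosSol ω 1 * b := by
  simp [d1_sol, solDeriv]
  ring

/-! ### Multiplicities as dimensions of parameter spaces -/

section Reduction

variable {E X : Type*} [AddCommGroup E] [Module ℂ E] [AddCommGroup X] [Module ℂ X]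

theorem finrank_eq_of_injOn_of_image {W : Submodule ℂ X} {W' : Submodule ℂ E} (Φ : X →ₗ[ℂ] E)
    (hinj : ∀ p ∈ W, Φ p = 0 → p = 0) (hΦ : ∀ u, u ∈ W' ↔ ∃ p ∈ W, Φ p = u) :
    Module.finrank ℂ W = Module.finrank ℂ W' := by
  have h1 : W' = LinearMap.range (Φ.domRestrict W) := by
    ext u
    rw [LinearMap.range_domRestrict, Submodule.mem_map, hΦ]
  have hi : Function.Injective (Φ.domRestrict W) := by
    rw [← LinearMap.ker_eq_bot, LinearMap.ker_eq_bot']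
    exact fun p hp => Subtype.ext (hinj p p.2 hp)
  rw [h1, LinearMap.finrank_range_of_inj hi]

/-- If the eigenfunctions are parametrized linearly and injectively by `W`, then the multiplicity
is the dimension of `W`. -/
theorem multNeg_eq_finrank (L : E →ₗ.[ℂ] E) (μ : ℂ) (W : Submodule ℂ X) (Φ : X →ₗ[ℂ] E)
    (hinj : ∀ p ∈ W, Φ p = 0 → p = 0)
    (hΦ : ∀ u, (∃ hu : u ∈ L.domain, -L.toFun ⟨u, hu⟩ = μ • u) ↔ ∃ p ∈ W, Φ p = u) :
    multNeg L μ = Module.finrank ℂ W := by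
  have h : Module.finrank ℂ (eigenspaceNeg L μ) =
      Module.finrank ℂ ((eigenspaceNeg L μ).map L.domain.subtype) :=
    (Submodule.equivMapOfInjective _ L.domain.injective_subtype _).finrank_eq
  rw [multNeg, h]
  refine (finrank_eq_of_injOn_of_image Φ hinj fun u => ?_).symm
  rw [Submodule.mem_map, ← hΦ]
  constructor
  · rintro ⟨⟨w, hw⟩, hm, rfl⟩
    refine ⟨hw, ?_⟩
    simpa [eigenspaceNeg, sub_eq_zero] using hm
  · rintro ⟨hu, h⟩
    refine ⟨⟨u, hu⟩, ?_, rfl⟩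
    simpa [eigenspaceNeg, sub_eq_zero] using h

end Reduction

/-! ### Edge ends and sums over the edges at a vertex -/

section Graph

variable {V : Type*} [Fintype V] [DecidableEq V] {G : SimpleGraph V} [DecidableRel G.Adj]

namespace Orientation

theorem adj (O : Orientation G) (e : G.edgeSet) : G.Adj (O.src e) (O.tgt e) := by
  rw [← SimpleGraph.mem_edgeSet, O.mk_eq]
  exact e.2

theorem src_ne_tgt (O : Orientation G) (e : G.edgeSet) : O.src e ≠ O.tgt e := (O.adj e).ne

theorem mem_iff (O : Orientation G) (e : G.edgeSet) (v : V) :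
    v ∈ (e : Sym2 V) ↔ v = O.src e ∨ v = O.tgt e := by
  rw [← O.mk_eq, Sym2.mem_iff]

@[simp] theorem pos_tgt (O : Orientation G) (e : G.edgeSet) : O.pos (O.tgt e) e = 1 := by
  simp [pos]

@[simp] theorem pos_src (O : Orientation G) (e : G.edgeSet) : O.pos (O.src e) e = 0 := by
  simp [pos, (O.src_ne_tgt e).symm]

@[simp] theorem inc_tgt (O : Orientation G) (e : G.edgeSet) : O.inc (O.tgt e) e = 1 := by
  simp [inc]

@[simp] theorem inc_src (O : Orientation G) (e : G.edgeSet) : O.inc (O.src e) e = -1 := by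
  simp [inc, (O.src_ne_tgt e).symm]

end Orientation

theorem exists_edge_of_degree_pos (hG : ∀ v, 0 < G.degree v) (v : V) :
    ∃ e : G.edgeSet, v ∈ (e : Sym2 V) := by
  obtain ⟨w, hw⟩ := (G.degree_pos_iff_exists_adj v).1 (hG v)
  exact ⟨⟨s(v, w), hw⟩, Sym2.mem_mk_left v w⟩

/-- Sum of an edge function over the edges with a given end point. -/
def push (p : G.edgeSet → V) : (G.edgeSet → ℂ) →ₗ[ℂ] (V → ℂ) where
  toFun g v := ∑ e, if p e = v then g e else 0
  map_add' g h := by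
    funext v
    simp only [Pi.add_apply, ← Finset.sum_add_distrib]
    exact Finset.sum_congr rfl fun e _ => by split_ifs <;> simp
  map_smul' a g := by
    funext v
    simp [Finset.mul_sum]

theorem push_apply (p : G.edgeSet → V) (g : G.edgeSet → ℂ) (v : V) :
    push p g v = ∑ e, if p e = v then g e else 0 := rfl

/-- Restriction of a vertex function to the end points of edges. -/
abbrev pull (p : G.edgeSet → V) : (V → ℂ) →ₗ[ℂ] (G.edgeSet → ℂ) := LinearMap.funLeft ℂ ℂ p

/-- An edge that misses `v` has the default parameter `0` there, but its incidence entry vanishes.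
An edge at `v` has `v` at exactly one end, so it enters exactly one of the two sums. -/
theorem sum_inc_mul (O : Orientation G) (g : G.edgeSet → unitInterval → ℂ) (v : V) :
    ∑ e, O.inc v e * g e (O.pos v e) =
      push O.tgt (fun e => g e 1) v - push O.src (fun e => g e 0) v := by
  rw [push_apply, push_apply, ← Finset.sum_sub_distrib]
  refine Finset.sum_congr rfl fun e _ => ?_
  by_cases h1 : O.tgt e = v
  · subst h1
    simp [O.src_ne_tgt e]
  · by_cases h2 : O.src e = v
    · subst h2
      simp [h1]
    · simp [Orientation.inc, h1, h2]

theorem sum_inc_sq_mul (O : Orientation G) (g : G.edgeSet → unitInterval → ℂ) (v : V) :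
    ∑ e, O.inc v e ^ 2 * g e (O.pos v e) =
      push O.tgt (fun e => g e 1) v + push O.src (fun e => g e 0) v := by
  rw [push_apply, push_apply, ← Finset.sum_add_distrib]
  refine Finset.sum_congr rfl fun e _ => ?_
  by_cases h1 : O.tgt e = v
  · subst h1
    simp [O.src_ne_tgt e]
  · by_cases h2 : O.src e = v
    · subst h2
      simp [h1]
    · simp [Orientation.inc, h1, h2]

/-- Values at the ends of edges that agree at every vertex come from a vertex function. -/
theorem agree_iff_exists_vertex_function (O : Orientation G) (hG : ∀ v, 0 < G.degree v)
    (g : V → G.edgeSet → ℂ) :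
    (∀ (v : V) (e f : G.edgeSet), v ∈ (e : Sym2 V) → v ∈ (f : Sym2 V) → g v e = g v f) ↔
      ∃ φ : V → ℂ, ∀ e, φ (O.src e) = g (O.src e) e ∧ φ (O.tgt e) = g (O.tgt e) e := by
  constructor
  · intro h
    -- As no vertex is isolated, `φ v` can be read off on any chosen edge at `v`.
    choose ε hε using exists_edge_of_degree_pos hG
    exact ⟨fun v => g v (ε v), fun e =>
      ⟨h _ _ _ (hε _) ((O.mem_iff _ _).2 (Or.inl rfl)),
        h _ _ _ (hε _) ((O.mem_iff _ _).2 (Or.inr rfl))⟩⟩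
  · rintro ⟨φ, hφ⟩ v e f he hf
    have key : ∀ e : G.edgeSet, v ∈ (e : Sym2 V) → g v e = φ v := by
      intro e he
      rcases (O.mem_iff _ _).1 he with rfl | rfl
      · exact (hφ e).1.symm
      · exact (hφ e).2.symm
    rw [key e he, key f hf]

/-! ### Eigenfunctions as data on vertices and edges -/

/-- Vertex values `φ` and initial slopes `b` of the `CK` eigenfunctions, where the fundamental
solutions take the values `C`, `S` at `1` and have the derivatives `-M`, `C` there. -/
def spaceCK (O : Orientation G) (C S M : ℂ) : Submodule ℂ ((V → ℂ) × (G.edgeSet → ℂ)) :=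
  LinearMap.ker (pull O.tgt ∘ₗ LinearMap.fst ℂ _ _ -
      (C • (pull O.src ∘ₗ LinearMap.fst ℂ _ _) + S • LinearMap.snd ℂ _ _)) ⊓
    LinearMap.ker (push O.tgt ∘ₗ (-M • (pull O.src ∘ₗ LinearMap.fst ℂ _ _) +
      C • LinearMap.snd ℂ _ _) - push O.src ∘ₗ LinearMap.snd ℂ _ _)

theorem mem_spaceCK (O : Orientation G) (C S M : ℂ) (φ : V → ℂ) (b : G.edgeSet → ℂ) :
    (φ, b) ∈ spaceCK O C S M ↔ (∀ e, φ (O.tgt e) = C * φ (O.src e) + S * b e) ∧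
      ∀ v, push O.tgt (fun e => -M * φ (O.src e) + C * b e) v = push O.src b v := by
  rw [spaceCK, Submodule.mem_inf, LinearMap.mem_ker, LinearMap.mem_ker]
  simp only [LinearMap.sub_apply, sub_eq_zero]
  exact and_congr funext_iff funext_iff

/-- Vertex values `ψ` of the outer normal derivatives and initial values `a` of the `KC`
eigenfunctions. -/
abbrev spaceKC (O : Orientation G) (C S M : ℂ) : Submodule ℂ ((V → ℂ) × (G.edgeSet → ℂ)) :=
  spaceCK O (-C) (-M) (-S)

/-- With initial slope `-ψ (src)`, the outer normal derivative at the target is `-C ψ (src) - M a`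
and the value there is `C a - S ψ (src)`. Exchanging the roles of values and normal derivatives thus
amounts to `(C, S, M) ↦ (-C, -M, -S)`, which preserves `C² + M S = 1`. -/
theorem mem_spaceKC (O : Orientation G) (C S M : ℂ) (ψ : V → ℂ) (a : G.edgeSet → ℂ) :
    (ψ, a) ∈ spaceKC O C S M ↔ (∀ e, ψ (O.tgt e) = -C * ψ (O.src e) + -M * a e) ∧
      ∀ v, push O.tgt (fun e => -S * ψ (O.src e) + C * a e) v = -push O.src a v := by
  have h : (fun e => - -S * ψ (O.src e) + -C * a e) =
      -fun e => -S * ψ (O.src e) + C * a e := by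
    funext e
    simp only [Pi.neg_apply]
    ring
  simp only [mem_spaceCK, h, map_neg, Pi.neg_apply, neg_eq_iff_eq_neg]

/-- The edgewise solutions with given initial values and slopes. -/
def solMap (G : SimpleGraph V) (ω : ℂ) :
    ((G.edgeSet → ℂ) × (G.edgeSet → ℂ)) →ₗ[ℂ] (G.edgeSet → unitInterval → ℂ) where
  toFun p e := sol ω (p.1 e) (p.2 e)
  map_add' p q := by
    funext e x
    simp only [sol, Prod.fst_add, Prod.snd_add, Pi.add_apply]
    ring
  map_smul' c p := by
    funext e x
    simp only [sol, Prod.smul_fst, Prod.smul_snd, Pi.smul_apply, smul_eq_mul, RingHom.id_apply]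
    ring

theorem solMap_apply (ω : ℂ) (p : (G.edgeSet → ℂ) × (G.edgeSet → ℂ)) (e : G.edgeSet) :
    solMap G ω p e = sol ω (p.1 e) (p.2 e) := rfl

theorem neg_secondDeriv_eq_iff {ω : ℂ} (D : Submodule ℂ (G.edgeSet → unitInterval → ℂ))
    (hD : ∀ u ∈ D, ∀ e, IsC2 (u e)) (u : G.edgeSet → unitInterval → ℂ) (hu : u ∈ D) :
    -(secondDeriv D hD).toFun ⟨u, hu⟩ = ω ^ 2 • u ↔
      u = solMap G ω (fun e => u e 0, fun e => d1 (u e) 0) := by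
  constructor
  · intro h
    funext e
    refine eq_sol_of_d2_eq (hD u hu e) fun x => ?_
    have := congrFun (congrFun h e) x
    change -d2 (u e) x = ω ^ 2 * u e x at this
    linear_combination -this
  · intro h
    funext e x
    change -d2 (u e) x = ω ^ 2 * u e x
    rw [h, solMap_apply, d2_sol]
    ring

theorem solMap_mem_domCK_iff (O : Orientation G) (hG : ∀ v, 0 < G.degree v) (ω : ℂ)
    (a b : G.edgeSet → ℂ) :
    solMap G ω (a, b) ∈ domCK O ↔ ∃ φ : V → ℂ, pull O.src φ = a ∧
      (φ, b) ∈ spaceCK O (cosSol ω 1) (sinSol ω 1) (ω ^ 2 * sinSol ω 1) := by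
  change (_ ∧ (∀ (v : V) (e f : G.edgeSet), _ → _ →
    (fun v e => solMap G ω (a, b) e (O.pos v e)) v e =
      (fun v e => solMap G ω (a, b) e (O.pos v e)) v f) ∧ _) ↔ _
  rw [agree_iff_exists_vertex_function O hG]
  simp only [sum_inc_mul O (fun e => d1 (sol ω (a e) (b e))), solMap_apply, isC2_sol,
    Orientation.pos_src, Orientation.pos_tgt, sol_zero, sol_one, d1_sol_zero, d1_sol_one,
    sub_eq_zero, implies_true, true_and, mem_spaceCK]
  constructor
  · rintro ⟨⟨φ, hφ⟩, hs⟩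
    obtain rfl : pull O.src φ = a := funext fun e => (hφ e).1
    refine ⟨φ, rfl, fun e => ?_, hs⟩
    rw [(hφ e).2, ← (hφ e).1]
    ring
  · rintro ⟨φ, rfl, h1, h2⟩
    exact ⟨⟨φ, fun e => ⟨rfl, by rw [h1, LinearMap.funLeft_apply]; ring⟩⟩, h2⟩

/-- At parameter `0` the outer normal derivative is minus the slope; hence the sign in the relation
between `ψ` and `b`. -/
theorem solMap_mem_domKC_iff (O : Orientation G) (hG : ∀ v, 0 < G.degree v) (ω : ℂ)
    (a b : G.edgeSet → ℂ) :
    solMap G ω (a, b) ∈ domKC O ↔ ∃ ψ : V → ℂ, -pull O.src ψ = b ∧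
      (ψ, a) ∈ spaceKC O (cosSol ω 1) (sinSol ω 1) (ω ^ 2 * sinSol ω 1) := by
  change (_ ∧ _ ∧ (∀ (v : V) (e f : G.edgeSet), _ → _ →
    (fun v e => O.inc v e * d1 (solMap G ω (a, b) e) (O.pos v e)) v e =
      (fun v e => O.inc v e * d1 (solMap G ω (a, b) e) (O.pos v e)) v f)) ↔ _
  rw [agree_iff_exists_vertex_function O hG]
  simp only [sum_inc_sq_mul O (fun e => sol ω (a e) (b e)), solMap_apply, isC2_sol,
    Orientation.pos_src, Orientation.pos_tgt, sol_zero, sol_one, d1_sol_zero, d1_sol_one,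
    Orientation.inc_src, Orientation.inc_tgt, implies_true, true_and, mem_spaceKC,
    add_eq_zero_iff_eq_neg]
  constructor
  · rintro ⟨hs, ψ, hψ⟩
    have hb : -pull O.src ψ = b := funext fun e => by
      rw [Pi.neg_apply, LinearMap.funLeft_apply, (hψ e).1]
      ring
    subst hb
    refine ⟨ψ, rfl, fun e => ?_, fun v => ?_⟩
    · rw [(hψ e).2, Pi.neg_apply, LinearMap.funLeft_apply]
      ring
    · rw [← hs v]
      refine congrFun (congrArg _ (funext fun e => ?_)) v
      rw [Pi.neg_apply, LinearMap.funLeft_apply]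
      ring
  · rintro ⟨ψ, rfl, h1, h2⟩
    refine ⟨fun v => ?_, ψ, fun e => ⟨?_, ?_⟩⟩
    · rw [← h2 v]
      refine congrFun (congrArg _ (funext fun e => ?_)) v
      rw [Pi.neg_apply, LinearMap.funLeft_apply]
      ring
    · rw [Pi.neg_apply, LinearMap.funLeft_apply]
      ring
    · rw [h1, Pi.neg_apply, LinearMap.funLeft_apply]
      ring

theorem vertex_function_eq_zero (O : Orientation G) (hG : ∀ v, 0 < G.degree v) {φ : V → ℂ}
    (h1 : ∀ e, φ (O.src e) = 0) (h2 : ∀ e, φ (O.tgt e) = 0) : φ = 0 := by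
  funext v
  obtain ⟨e, he⟩ := exists_edge_of_degree_pos hG v
  rcases (O.mem_iff _ _).1 he with rfl | rfl
  · exact h1 e
  · exact h2 e

theorem solMap_eq_zero {ω : ℂ} {a b : G.edgeSet → ℂ} (h : solMap G ω (a, b) = 0) :
    a = 0 ∧ b = 0 := by
  have he : ∀ e, sol ω (a e) (b e) = 0 := fun e => congrFun h e
  refine ⟨funext fun e => ?_, funext fun e => ?_⟩
  · rw [← sol_zero ω (a e) (b e), he]
    rfl
  · rw [← d1_sol_zero ω (a e) (b e), he]
    exact d1_zero 0

/-- The eigenfunction sees `φ` only at ends of edges, so the parametrization is injective because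
every vertex lies on an edge. -/
theorem multNeg_laplacianCK (O : Orientation G) (hG : ∀ v, 0 < G.degree v) (ω : ℂ) :
    multNeg (laplacianCK O) (ω ^ 2) = Module.finrank ℂ
      (spaceCK O (cosSol ω 1) (sinSol ω 1) (ω ^ 2 * sinSol ω 1)) := by
  refine multNeg_eq_finrank _ _ _ (solMap G ω ∘ₗ
    (pull O.src ∘ₗ LinearMap.fst ℂ _ _).prod (LinearMap.snd ℂ _ _)) ?_ fun u => ?_
  · rintro ⟨φ, b⟩ hp h0
    obtain ⟨ha, hb⟩ := solMap_eq_zero h0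
    have hb : b = 0 := hb
    have h1 : ∀ e, φ (O.src e) = 0 := fun e => congrFun ha e
    have h2 := ((mem_spaceCK ..).1 hp).1
    rw [vertex_function_eq_zero O hG h1 fun e => by rw [h2, h1, hb]; simp, hb]
    rfl
  · constructor
    · rintro ⟨hu, h⟩
      have hs := (neg_secondDeriv_eq_iff (domCK O) (fun _ hu => hu.1) u hu).1 h
      have hu' : u ∈ domCK O := hu
      rw [hs] at hu'
      obtain ⟨φ, hφ, hm⟩ := (solMap_mem_domCK_iff O hG ω _ _).1 hu'
      refine ⟨_, hm, ?_⟩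
      conv_rhs => rw [hs, ← hφ]
      rfl
    · rintro ⟨⟨φ, b⟩, hp, rfl⟩
      have hu : solMap G ω (pull O.src φ, b) ∈ domCK O :=
        (solMap_mem_domCK_iff O hG ω _ _).2 ⟨φ, rfl, hp⟩
      refine ⟨hu, (neg_secondDeriv_eq_iff (domCK O) (fun _ hu => hu.1) _ hu).2 ?_⟩
      simp [solMap_apply]
      rfl

theorem multNeg_laplacianKC (O : Orientation G) (hG : ∀ v, 0 < G.degree v) (ω : ℂ) :
    multNeg (laplacianKC O) (ω ^ 2) = Module.finrank ℂ
      (spaceKC O (cosSol ω 1) (sinSol ω 1) (ω ^ 2 * sinSol ω 1)) := by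
  refine multNeg_eq_finrank _ _ _ (solMap G ω ∘ₗ
    (LinearMap.snd ℂ _ _).prod (-(pull O.src ∘ₗ LinearMap.fst ℂ _ _))) ?_ fun u => ?_
  · rintro ⟨ψ, a⟩ hp h0
    obtain ⟨ha, hb⟩ := solMap_eq_zero h0
    have ha : a = 0 := ha
    have h1 : ∀ e, ψ (O.src e) = 0 := fun e => neg_eq_zero.1 (congrFun hb e)
    have h2 := ((mem_spaceKC ..).1 hp).1
    rw [vertex_function_eq_zero O hG h1 fun e => by rw [h2, h1, ha]; simp, ha]
    rfl
  · constructor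
    · rintro ⟨hu, h⟩
      have hs := (neg_secondDeriv_eq_iff (domKC O) (fun _ hu => hu.1) u hu).1 h
      have hu' : u ∈ domKC O := hu
      rw [hs] at hu'
      obtain ⟨ψ, hψ, hm⟩ := (solMap_mem_domKC_iff O hG ω _ _).1 hu'
      refine ⟨_, hm, ?_⟩
      conv_rhs => rw [hs, ← hψ]
      rfl
    · rintro ⟨⟨ψ, a⟩, hp, rfl⟩
      have hu : solMap G ω (a, -pull O.src ψ) ∈ domKC O :=
        (solMap_mem_domKC_iff O hG ω _ _).2 ⟨ψ, rfl, hp⟩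
      refine ⟨hu, (neg_secondDeriv_eq_iff (domKC O) (fun _ hu => hu.1) _ hu).2 ?_⟩
      simp [solMap_apply]
      rfl

/-! ### The equation `A φ = l D φ` -/

/-- The space of `φ` with `A φ = l D φ`, for the adjacency matrix `A` and the diagonal matrix `D`
of the degrees. -/
def adjKer (G : SimpleGraph V) [DecidableRel G.Adj] (l : ℂ) : Submodule ℂ (V → ℂ) :=
  LinearMap.ker ((G.adjMatrix ℂ).mulVecLin -
    l • (Matrix.diagonal fun v => (G.degree v : ℂ)).mulVecLin)

theorem mem_adjKer {l : ℂ} {φ : V → ℂ} :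
    φ ∈ adjKer G l ↔ ∀ v, ∑ w ∈ G.neighborFinset v, φ w = l * (G.degree v * φ v) := by
  rw [adjKer, LinearMap.mem_ker, LinearMap.sub_apply, sub_eq_zero, funext_iff]
  simp [SimpleGraph.adjMatrix_mulVec_apply, Matrix.mulVec_diagonal]

/-- Neighbours `w` correspond to edges `s(v, w)`. Each of these has `v` at exactly one end and
contributes the value at the other. -/
theorem sum_neighborFinset_eq (O : Orientation G) (h : V → ℂ) (v : V) :
    ∑ w ∈ G.neighborFinset v, h w =
      push O.tgt (pull O.src h) v + push O.src (pull O.tgt h) v := by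
  rw [push_apply, push_apply, ← Finset.sum_add_distrib, ← Finset.sum_coe_sort]
  have hadj : ∀ w : G.neighborFinset v, G.Adj v w := fun w =>
    (G.mem_neighborFinset v w).1 w.2
  refine Finset.sum_of_injOn (fun w => (⟨s(v, w), hadj w⟩ : G.edgeSet)) ?_ (by simp) ?_ ?_
  · intro w _ w' _ hw
    have := congrArg Subtype.val hw
    exact Subtype.ext (Sym2.congr_right.1 this)
  · intro e _ he
    have h1 : O.tgt e ≠ v := by
      rintro rfl
      refine he ⟨⟨O.src e, by simpa using (O.adj e).symm⟩, by simp, Subtype.ext ?_⟩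
      rw [← O.mk_eq e, Sym2.eq_swap]
    have h2 : O.src e ≠ v := by
      rintro rfl
      exact he ⟨⟨O.tgt e, by simpa using O.adj e⟩, by simp, Subtype.ext (O.mk_eq e)⟩
    simp [h1, h2]
  · intro w _
    have hne := (hadj w).ne
    rcases Sym2.eq_iff.1 (O.mk_eq ⟨s(v, w), hadj w⟩) with ⟨h1, h2⟩ | ⟨h1, h2⟩
    · simp [LinearMap.funLeft_apply, h1, h2, hne.symm]
    · simp [LinearMap.funLeft_apply, h1, h2, hne.symm]

theorem degree_mul_eq (O : Orientation G) (φ : V → ℂ) (v : V) :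
    G.degree v * φ v = push O.tgt (pull O.tgt φ) v + push O.src (pull O.src φ) v := by
  -- For the constant function with value `φ v`, the neighbour sum is the degree times `φ v`.
  have h := sum_neighborFinset_eq O (fun _ => φ v) v
  simp only [Finset.sum_const, SimpleGraph.card_neighborFinset_eq_degree, nsmul_eq_mul] at h
  rw [h]
  simp only [push_apply, LinearMap.funLeft_apply]
  congr 1 <;> refine Finset.sum_congr rfl fun e _ => ?_ <;> split_ifs with h <;> simp [h]

/-- The equation `l D φ = A φ` is split over the two kinds of edge ends. For `l = C` the two sides
are `S` times the final and the initial slopes of the edge solutions, which is the shape of the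
Kirchhoff condition. -/
theorem mem_adjKer_iff (O : Orientation G) {l : ℂ} {φ : V → ℂ} :
    φ ∈ adjKer G l ↔ ∀ v, push O.tgt (fun e => l * φ (O.tgt e) - φ (O.src e)) v =
      push O.src (fun e => φ (O.tgt e) - l * φ (O.src e)) v := by
  rw [mem_adjKer]
  refine forall_congr' fun v => ?_
  have h1 : (fun e => l * φ (O.tgt e) - φ (O.src e)) = l • pull O.tgt φ - pull O.src φ := rfl
  have h2 : (fun e => φ (O.tgt e) - l * φ (O.src e)) = pull O.tgt φ - l • pull O.src φ := rfl
  rw [degree_mul_eq O, sum_neighborFinset_eq O, h1, h2]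
  simp only [map_sub, map_smul, Pi.sub_apply, Pi.smul_apply, smul_eq_mul]
  constructor <;> intro h <;> linear_combination -h

/-- `push p` is the transpose of `pull p`; this serves as summation by parts in the energy
arguments. -/
theorem sum_mul_push (p : G.edgeSet → V) (g : V → ℂ) (h : G.edgeSet → ℂ) :
    ∑ v, g v * push p h v = ∑ e, g (p e) * h e := by
  simp only [push_apply, Finset.mul_sum]
  rw [Finset.sum_comm]
  simp

theorem eq_zero_of_sum_star_mul_eq_zero {ι : Type*} [Fintype ι] {f : ι → ℂ}
    (h : ∑ i, star (f i) * f i = 0) (i : ι) : f i = 0 := by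
  have h' : ((∑ i, Complex.normSq (f i) : ℝ) : ℂ) = 0 := by
    rw [← h, Complex.ofReal_sum]
    exact Finset.sum_congr rfl fun i _ => (Complex.normSq_eq_conj_mul_self)
  rw [Complex.ofReal_eq_zero, Finset.sum_eq_zero_iff_of_nonneg fun i _ => Complex.normSq_nonneg _]
    at h'
  exact Complex.normSq_eq_zero.1 (h' i (Finset.mem_univ i))

/-- For `l = ±1` the space `A φ = l D φ` consists of the (alternating) locally constant
functions. -/
theorem mem_adjKer_iff_of_sq_eq_one (O : Orientation G) {l : ℂ} (hl : l = 1 ∨ l = -1)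
    {φ : V → ℂ} : φ ∈ adjKer G l ↔ ∀ e, φ (O.tgt e) = l * φ (O.src e) := by
  have hl2 : l * l = 1 := by rcases hl with rfl | rfl <;> ring
  have hls : star l = l := by rcases hl with rfl | rfl <;> simp
  rw [mem_adjKer_iff O]
  constructor
  · intro h e
    rw [← sub_eq_zero]
    refine eq_zero_of_sum_star_mul_eq_zero (f := fun e => φ (O.tgt e) - l * φ (O.src e)) ?_ e
    -- Testing the equation against `star φ` and multiplying by `l` gives `∑ |φ (tgt) - l φ (src)|²
    -- = 0`, since `l` is real with `l² = 1`.
    have h1 : ∑ v, star (φ v) * push O.tgt (fun e => l * φ (O.tgt e) - φ (O.src e)) v =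
        ∑ v, star (φ v) * push O.src (fun e => φ (O.tgt e) - l * φ (O.src e)) v :=
      Finset.sum_congr rfl fun v _ => by rw [h]
    rw [sum_mul_push O.tgt (fun v => star (φ v)), sum_mul_push O.src (fun v => star (φ v)),
      ← sub_eq_zero, ← Finset.sum_sub_distrib] at h1
    have h2 := congrArg (l * ·) h1
    simp only [mul_zero, Finset.mul_sum] at h2
    rw [← h2]
    refine Finset.sum_congr rfl fun e _ => ?_
    rw [star_sub, star_mul', hls]
    linear_combination
      (-star (φ (O.tgt e)) * φ (O.tgt e) - 0 * φ (O.src e)) * hl2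
  · intro h v
    refine congrFun ?_ v
    have h1 : (fun e => l * φ (O.tgt e) - φ (O.src e)) = 0 := funext fun e => by
      rw [h]
      simp only [Pi.zero_apply]
      linear_combination φ (O.src e) * hl2
    have h2 : (fun e => φ (O.tgt e) - l * φ (O.src e)) = 0 := funext fun e => by
      rw [h, sub_self]
      rfl
    rw [h1, h2, map_zero, map_zero]

/-! ### Balanced flows and the dimensions of the data spaces -/

/-- Balanced edge functions; for `l = 1` the cycle space. -/
def flowSpace (O : Orientation G) (l : ℂ) : Submodule ℂ (G.edgeSet → ℂ) :=
  LinearMap.ker (l • push O.tgt - push O.src)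

theorem mem_flowSpace (O : Orientation G) {l : ℂ} {b : G.edgeSet → ℂ} :
    b ∈ flowSpace O l ↔ ∀ v, l * push O.tgt b v = push O.src b v := by
  rw [flowSpace, LinearMap.mem_ker, LinearMap.sub_apply, sub_eq_zero, funext_iff]
  rfl

/-- Flows form the kernel of an incidence matrix with `n` rows and `N` columns, and for `l = ±1` the
space `adjKer G l` is the kernel of its transpose. Both matrices have the same rank, so rank-nullity
applies twice. -/
theorem finrank_flowSpace (O : Orientation G) {l : ℂ} (hl : l = 1 ∨ l = -1) :
    Module.finrank ℂ (flowSpace O l) + Fintype.card V =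
      G.edgeFinset.card + Module.finrank ℂ (adjKer G l) := by
  have hl2 : l * l = 1 := by rcases hl with rfl | rfl <;> ring
  let K : Matrix V G.edgeSet ℂ := Matrix.of fun v e =>
    l * (if O.tgt e = v then 1 else 0) - if O.src e = v then 1 else 0
  have hK : ∀ v e, K v e = l * (if O.tgt e = v then 1 else 0) - if O.src e = v then 1 else 0 :=
    fun _ _ => rfl
  have h1 : flowSpace O l = LinearMap.ker K.mulVecLin := by
    ext b
    rw [mem_flowSpace, LinearMap.mem_ker, funext_iff]
    refine forall_congr' fun v => ?_
    rw [← sub_eq_zero]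
    have : K.mulVecLin b v = l * push O.tgt b v - push O.src b v := by
      simp only [Matrix.mulVecLin_apply, Matrix.mulVec, dotProduct, push_apply, hK,
        Finset.mul_sum, ← Finset.sum_sub_distrib]
      refine Finset.sum_congr rfl fun e _ => ?_
      split_ifs <;> ring
    rw [this]
    rfl
  have h2 : adjKer G l = LinearMap.ker K.transpose.mulVecLin := by
    ext φ
    rw [mem_adjKer_iff_of_sq_eq_one O hl, LinearMap.mem_ker, funext_iff]
    refine forall_congr' fun e => ?_
    have : K.transpose.mulVecLin φ e = l * φ (O.tgt e) - φ (O.src e) := by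
      simp [Matrix.vecMul, dotProduct, hK, mul_sub, Finset.sum_sub_distrib, mul_comm]
    rw [this, Pi.zero_apply, sub_eq_zero]
    constructor <;> intro h
    · rw [h]; linear_combination φ (O.src e) * hl2
    · rw [← h]; linear_combination -φ (O.tgt e) * hl2
  have r1 := K.mulVecLin.finrank_range_add_finrank_ker
  have r2 := K.transpose.mulVecLin.finrank_range_add_finrank_ker
  have r3 : Module.finrank ℂ (LinearMap.range K.transpose.mulVecLin) =
    Module.finrank ℂ (LinearMap.range K.mulVecLin) := K.rank_transpose
  rw [← h1] at r1
  rw [← h2, r3] at r2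
  rw [Module.finrank_fintype_fun_eq_card] at r1 r2
  rw [SimpleGraph.edgeFinset_card]
  omega

/-- Since `S ≠ 0`, the edge condition solves for `b` in terms of `φ`. Multiplied by `S` and
rewritten with `C² + M S = 1`, the flow condition becomes `A φ = C D φ`. -/
theorem finrank_spaceCK_of_ne_zero (O : Orientation G) {C S M : ℂ} (h : C ^ 2 + M * S = 1)
    (hS : S ≠ 0) :
    Module.finrank ℂ (spaceCK O C S M) = Module.finrank ℂ (adjKer G C) := by
  have key : ∀ (φ : V → ℂ) (b : G.edgeSet → ℂ),
      (∀ e, φ (O.tgt e) = C * φ (O.src e) + S * b e) →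
      ((∀ v, push O.tgt (fun e => -M * φ (O.src e) + C * b e) v = push O.src b v) ↔
        φ ∈ adjKer G C) := by
    intro φ b hb
    have h1 : (fun e => C * φ (O.tgt e) - φ (O.src e)) =
        S • fun e => -M * φ (O.src e) + C * b e := funext fun e => by
      rw [hb, Pi.smul_apply, smul_eq_mul]
      linear_combination φ (O.src e) * h
    have h2 : (fun e => φ (O.tgt e) - C * φ (O.src e)) = S • b := funext fun e => by
      rw [hb, Pi.smul_apply, smul_eq_mul]
      ring
    rw [mem_adjKer_iff O, h1, h2, map_smul, map_smul]
    refine forall_congr' fun v => ?_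
    simp [hS]
  refine finrank_eq_of_injOn_of_image (LinearMap.fst ℂ _ _) ?_ fun φ => ?_
  · rintro ⟨φ, b⟩ hp (rfl : φ = 0)
    have h1 := ((mem_spaceCK ..).1 hp).1
    have : b = 0 := funext fun e => by simpa [hS] using h1 e
    rw [this]
    rfl
  · constructor
    · intro hφ
      have hb : ∀ e, φ (O.tgt e) =
          C * φ (O.src e) + S * (S⁻¹ * (φ (O.tgt e) - C * φ (O.src e))) := fun e => by
        rw [mul_inv_cancel_left₀ hS]
        ring
      exact ⟨(φ, fun e => S⁻¹ * (φ (O.tgt e) - C * φ (O.src e))),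
        (mem_spaceCK ..).2 ⟨hb, (key φ _ hb).2 hφ⟩, rfl⟩
    · rintro ⟨⟨φ, b⟩, hp, rfl⟩
      obtain ⟨h1, h2⟩ := (mem_spaceCK ..).1 hp
      exact (key φ b h1).1 h2

theorem finrank_submodule_prod {X Y : Type*} [AddCommGroup X] [Module ℂ X] [AddCommGroup Y]
    [Module ℂ Y] [FiniteDimensional ℂ X] [FiniteDimensional ℂ Y] (W : Submodule ℂ X)
    (W' : Submodule ℂ Y) :
    Module.finrank ℂ (W.prod W') = Module.finrank ℂ W + Module.finrank ℂ W' := by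
  rw [← Module.finrank_prod]
  exact LinearEquiv.finrank_eq
    { toFun := fun p => (⟨p.1.1, p.2.1⟩, ⟨p.1.2, p.2.2⟩)
      invFun := fun q => ⟨(q.1, q.2), q.1.2, q.2.2⟩
      map_add' := fun _ _ => rfl
      map_smul' := fun _ _ => rfl
      left_inv := fun _ => rfl
      right_inv := fun _ => rfl }

/-- The conditions on `φ` and `b` decouple, and the data space is the product of `adjKer G C` and
`flowSpace O C`. Each factor contributes one copy of the dimension of `adjKer G C`. -/
theorem finrank_spaceCK_of_eq_zero (O : Orientation G) {C : ℂ} (hC : C = 1 ∨ C = -1) :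
    Module.finrank ℂ (spaceCK O C 0 0) + Fintype.card V =
      G.edgeFinset.card + 2 * Module.finrank ℂ (adjKer G C) := by
  have h : spaceCK O C 0 0 = (adjKer G C).prod (flowSpace O C) := by
    ext ⟨φ, b⟩
    rw [mem_spaceCK, Submodule.mem_prod, mem_adjKer_iff_of_sq_eq_one O hC, mem_flowSpace]
    have hb : (fun e => -0 * φ (O.src e) + C * b e) = C • b := funext fun e => by simp
    simp only [hb, map_smul, Pi.smul_apply, smul_eq_mul, zero_mul, add_zero]
  rw [h, finrank_submodule_prod]
  have := finrank_flowSpace O hC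
  omega

/-- Tested against `star φ`, the flow condition loses its terms in `b`, because `φ (tgt) = C φ
(src)` and `C² = 1`. What remains is `M C ∑ |φ (src)|² = 0`, so `φ = 0` and only the flows survive.
-/
theorem finrank_spaceCK_of_slope_eq_zero (O : Orientation G) (hG : ∀ v, 0 < G.degree v)
    {C M : ℂ} (hC : C = 1 ∨ C = -1) (hM : M ≠ 0) :
    Module.finrank ℂ (spaceCK O C 0 M) + Fintype.card V =
      G.edgeFinset.card + Module.finrank ℂ (adjKer G C) := by
  rw [← finrank_flowSpace O hC]
  congr 1
  have hCs : star C = C := by rcases hC with rfl | rfl <;> simp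
  have hC2 : C * C = 1 := by rcases hC with rfl | rfl <;> ring
  have hC0 : C ≠ 0 := by rcases hC with rfl | rfl <;> simp
  have key : ∀ (φ : V → ℂ) (b : G.edgeSet → ℂ), (φ, b) ∈ spaceCK O C 0 M → φ = 0 := by
    intro φ b hp
    obtain ⟨h1, h2⟩ := (mem_spaceCK ..).1 hp
    have h1 : ∀ e, φ (O.tgt e) = C * φ (O.src e) := fun e => by simpa using h1 e
    have h3 : ∑ v, star (φ v) * push O.tgt (fun e => -M * φ (O.src e) + C * b e) v =
        ∑ v, star (φ v) * push O.src b v := Finset.sum_congr rfl fun v _ => by rw [h2]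
    rw [sum_mul_push O.tgt (fun v => star (φ v)), sum_mul_push O.src (fun v => star (φ v)),
      ← sub_eq_zero, ← Finset.sum_sub_distrib] at h3
    have h4 : ∀ e, φ (O.src e) = 0 := by
      refine eq_zero_of_sum_star_mul_eq_zero ?_
      have : (-M * C) * ∑ e, star (φ (O.src e)) * φ (O.src e) = 0 := by
        rw [← h3, Finset.mul_sum]
        refine Finset.sum_congr rfl fun e _ => ?_
        rw [h1, star_mul', hCs]
        linear_combination -(star (φ (O.src e)) * b e) * hC2
      simpa [hM, hC0] using this
    exact vertex_function_eq_zero O hG h4 fun e => by rw [h1, h4, mul_zero]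
  have hb : ∀ b : G.edgeSet → ℂ, (0, b) ∈ spaceCK O C 0 M ↔ b ∈ flowSpace O C := by
    intro b
    rw [mem_spaceCK, mem_flowSpace]
    have hb : (fun e => -M * (0 : V → ℂ) (O.src e) + C * b e) = C • b := funext fun e => by simp
    rw [hb, map_smul]
    simp
  refine finrank_eq_of_injOn_of_image (LinearMap.snd ℂ _ _) ?_ fun b => ?_
  · rintro ⟨φ, b⟩ hp (rfl : b = 0)
    rw [key φ 0 hp]
    rfl
  · constructor
    · exact fun h => ⟨(0, b), (hb b).2 h, rfl⟩
    · rintro ⟨⟨φ, b⟩, hp, rfl⟩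
      obtain rfl := key φ b hp
      exact (hb b).1 hp

theorem mem_adjKer_iff_forall_adj {l : ℂ} (hl : l = 1 ∨ l = -1) {φ : V → ℂ} :
    φ ∈ adjKer G l ↔ ∀ u v, G.Adj u v → φ v = l * φ u := by
  obtain ⟨O⟩ : Nonempty (Orientation G) := inferInstance
  have hl2 : l * l = 1 := by rcases hl with rfl | rfl <;> ring
  rw [mem_adjKer_iff_of_sq_eq_one O hl]
  constructor
  · intro h u v huv
    have he := h ⟨s(u, v), huv⟩
    rcases Sym2.eq_iff.1 (O.mk_eq ⟨s(u, v), huv⟩) with ⟨h1, h2⟩ | ⟨h1, h2⟩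
    · rwa [h1, h2] at he
    · rw [h1, h2] at he
      rw [he]
      linear_combination -φ v * hl2
  · exact fun h e => h _ _ (O.adj e)

/-! ### Locally constant and alternating functions on the components -/

/-- A function that is constant along edges factors through the connected components. -/
theorem exists_eq_comp_connectedComponentMk {V α : Type*} {G : SimpleGraph V} {f : V → α}
    (h : ∀ u v, G.Adj u v → f v = f u) :
    ∃ g : G.ConnectedComponent → α, ∀ v, g (G.connectedComponentMk v) = f v := by
  have key : ∀ v w, G.Walk v w → f v = f w := by
    intro v w p
    induction p with
    | nil => rfl
    | cons hadj p ih => rw [← h _ _ hadj, ih]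
  exact ⟨SimpleGraph.ConnectedComponent.lift f fun v w p _ => key v w p, fun v => rfl⟩

theorem finrank_adjKer_one : Module.finrank ℂ (adjKer G 1) = numComp G := by
  classical
  have := Fintype.ofFinite G.ConnectedComponent
  have h := finrank_eq_of_injOn_of_image (W := ⊤) (W' := adjKer G 1)
    (LinearMap.funLeft ℂ ℂ G.connectedComponentMk) ?_ fun φ => ?_
  · rw [← h, finrank_top, Module.finrank_fintype_fun_eq_card, numComp, Nat.card_eq_fintype_card]
  · intro g _ hg
    funext C
    induction C using SimpleGraph.ConnectedComponent.ind with
    | h v => exact congrFun hg v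
  · rw [mem_adjKer_iff_forall_adj (Or.inl rfl)]
    constructor
    · intro hφ
      obtain ⟨g, hg⟩ := exists_eq_comp_connectedComponentMk (f := φ)
        fun u v huv => by rw [hφ u v huv, one_mul]
      exact ⟨g, Submodule.mem_top, funext hg⟩
    · rintro ⟨g, -, rfl⟩ u v huv
      rw [one_mul, LinearMap.funLeft_apply, LinearMap.funLeft_apply,
        SimpleGraph.ConnectedComponent.connectedComponentMk_eq_of_adj huv]

/-- A sign function alternating along the edges of the bipartite components. -/
theorem exists_sign_function {V : Type*} (G : SimpleGraph V) :
    ∃ ε : V → ℂ, (∀ v, ε v * ε v = 1) ∧ ∀ u v, G.Adj u v →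
      (G.connectedComponentMk u).toSimpleGraph.IsBipartite → ε v = -ε u := by
  classical
  have hcol : ∀ C : {C : G.ConnectedComponent // C.toSimpleGraph.IsBipartite},
      ∃ c : C.1 → Fin 2, ∀ x y, C.1.toSimpleGraph.Adj x y → c x ≠ c y := fun C =>
    ⟨fun x => C.2.some x, fun x y h => C.2.some.valid h⟩
  choose c hc using hcol
  let sgn : Fin 2 → ℂ := ![1, -1]
  have hs1 : ∀ i, sgn i * sgn i = 1 := by
    intro i
    fin_cases i <;> simp [sgn]
  have hs2 : ∀ i j, i ≠ j → sgn j = -sgn i := by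
    intro i j
    fin_cases i <;> fin_cases j <;> simp [sgn]
  let ε : V → ℂ := fun v => if h : (G.connectedComponentMk v).toSimpleGraph.IsBipartite then
    sgn (c ⟨_, h⟩ ⟨v, rfl⟩) else 1
  have hε : ∀ (C : G.ConnectedComponent) (h : C.toSimpleGraph.IsBipartite) (v : V)
      (hv : G.connectedComponentMk v = C), ε v = sgn (c ⟨C, h⟩ ⟨v, hv⟩) := by
    rintro C h v rfl
    exact dif_pos h
  refine ⟨ε, fun v => ?_, fun u v huv h => ?_⟩
  · by_cases h : (G.connectedComponentMk v).toSimpleGraph.IsBipartite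
    · rw [hε _ h v rfl, hs1]
    · simp [ε, h]
  · have hv := (SimpleGraph.ConnectedComponent.connectedComponentMk_eq_of_adj huv).symm
    rw [hε _ h u rfl, hε _ h v hv]
    exact hs2 _ _ (hc ⟨_, h⟩ _ _ huv)

/-- An alternating function vanishes on the components that are not bipartite. -/
theorem alternating_eq_zero {V : Type*} {G : SimpleGraph V} {φ : V → ℂ}
    (h : ∀ u v, G.Adj u v → φ v = -φ u) {v : V}
    (hv : ¬ (G.connectedComponentMk v).toSimpleGraph.IsBipartite) : φ v = 0 := by
  classical
  by_contra h0
  apply hv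
  -- The square of `φ` is constant on the component, so `φ` takes only the values `±φ v` there. If
  -- `φ v ≠ 0`, these two values form a proper 2-colouring.
  obtain ⟨g, hg⟩ := exists_eq_comp_connectedComponentMk (f := fun v => φ v ^ 2)
    fun u v huv => by rw [h u v huv, neg_sq]
  have hsq : ∀ w, G.connectedComponentMk w = G.connectedComponentMk v →
      φ w = φ v ∨ φ w = -φ v := by
    intro w hw
    rw [← sq_eq_sq_iff_eq_or_eq_neg, ← hg w, ← hg v, hw]
  refine ⟨SimpleGraph.Coloring.mk (fun x => if φ x.1 = φ v then 0 else 1) ?_⟩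
  rintro ⟨x, hx⟩ ⟨y, hy⟩ hxy hc
  have hadj : G.Adj x y := hxy
  have hyx := h x y hadj
  have hne : φ v ≠ -φ v := fun h1 => h0 (self_eq_neg.1 h1)
  rcases hsq x hx with h1 | h1
  · simp [hyx, h1, hne.symm] at hc
  · simp [hyx, h1, hne.symm] at hc

/-- Multiplication by the sign function `ε` exchanges alternating and constant functions on a
bipartite component; the other components carry no nonzero alternating function. -/
theorem finrank_adjKer_neg_one : Module.finrank ℂ (adjKer G (-1)) = numBipComp G := by
  classical
  have := Fintype.ofFinite {C : G.ConnectedComponent // C.toSimpleGraph.IsBipartite}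
  obtain ⟨ε, hε1, hε2⟩ := exists_sign_function G
  have hε0 : ∀ v, ε v ≠ 0 := fun v h => by simpa [h] using hε1 v
  let Φ : ({C : G.ConnectedComponent // C.toSimpleGraph.IsBipartite} → ℂ) →ₗ[ℂ] (V → ℂ) :=
    { toFun := fun g v => if h : (G.connectedComponentMk v).toSimpleGraph.IsBipartite then
        g ⟨_, h⟩ * ε v else 0
      map_add' := fun g g' => by
        funext v
        by_cases h : (G.connectedComponentMk v).toSimpleGraph.IsBipartite <;> simp [h, add_mul]
      map_smul' := fun a g => by
        funext v
        by_cases h : (G.connectedComponentMk v).toSimpleGraph.IsBipartite <;> simp [h, mul_assoc] }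
  have hΦ1 : ∀ g v (C : G.ConnectedComponent) (h : C.toSimpleGraph.IsBipartite),
      G.connectedComponentMk v = C → Φ g v = g ⟨C, h⟩ * ε v := by
    rintro g v C h rfl
    exact dif_pos h
  have hΦ0 : ∀ g v, ¬ (G.connectedComponentMk v).toSimpleGraph.IsBipartite → Φ g v = 0 :=
    fun g v h => dif_neg h
  have h := finrank_eq_of_injOn_of_image (W := ⊤) (W' := adjKer G (-1)) Φ ?_ fun φ => ?_
  · rw [← h, finrank_top, Module.finrank_fintype_fun_eq_card, numBipComp,
      Nat.card_eq_fintype_card]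
  · intro g _ hg
    funext ⟨C, hC⟩
    obtain ⟨v, rfl⟩ := C.exists_rep
    have := congrFun hg v
    rw [hΦ1 g v _ hC rfl] at this
    exact (mul_eq_zero.1 this).resolve_right (hε0 v)
  · rw [mem_adjKer_iff_forall_adj (Or.inr rfl)]
    simp only [neg_one_mul]
    constructor
    · intro hφ
      obtain ⟨g, hg⟩ := exists_eq_comp_connectedComponentMk (f := fun v => φ v * ε v)
        fun u v huv => by
          by_cases h : (G.connectedComponentMk u).toSimpleGraph.IsBipartite
          · rw [hφ u v huv, hε2 u v huv h, neg_mul_neg]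
          · rw [hφ u v huv, alternating_eq_zero hφ h]
            simp
      refine ⟨fun C => g C.1, Submodule.mem_top, funext fun v => ?_⟩
      by_cases h : (G.connectedComponentMk v).toSimpleGraph.IsBipartite
      · rw [hΦ1 _ v _ h rfl, hg, mul_assoc, hε1, mul_one]
      · rw [hΦ0 _ v h, alternating_eq_zero hφ h]
    · rintro ⟨g, -, rfl⟩ u v huv
      have hc := SimpleGraph.ConnectedComponent.connectedComponentMk_eq_of_adj huv
      by_cases h : (G.connectedComponentMk u).toSimpleGraph.IsBipartite
      · rw [hΦ1 g u _ h rfl, hΦ1 g v _ h hc.symm, hε2 u v huv h, mul_neg]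
      · rw [hΦ0 g u h, hΦ0 g v (hc ▸ h), neg_zero]

/-! ### The number of vertices as a sum of dimensions -/

/-- The dimensions of the eigenspaces of a symmetric operator add up. -/
theorem finrank_eq_finsum_eigenspace {E : Type*} [NormedAddCommGroup E] [InnerProductSpace ℂ E]
    [FiniteDimensional ℂ E] {T : E →ₗ[ℂ] E} (hT : T.IsSymmetric) :
    Module.finrank ℂ E = ∑ᶠ l : ℂ, Module.finrank ℂ (Module.End.eigenspace T l) := by
  classical
  have hI := hT.direct_sum_isInternal
  have e := LinearEquiv.ofBijective (DirectSum.coeLinearMap _) hI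
  rw [← e.finrank_eq, Module.finrank_directSum, ← finsum_eq_sum_of_fintype,
    ← finsum_mem_univ (fun l : ℂ => Module.finrank ℂ (Module.End.eigenspace T l))]
  refine (finsum_subtype_eq_finsum_cond
    (f := fun l : ℂ => Module.finrank ℂ (Module.End.eigenspace T l)) _).trans ?_
  -- A number that is not an eigenvalue has trivial eigenspace, so summing over all of `ℂ` adds
  -- nothing.
  refine finsum_mem_inter_support_eq' _ {l | Module.End.HasEigenvalue T l} _ fun l hl => ?_
  refine iff_of_true (fun h => hl ?_) (mem_univ l)
  have h' : Module.End.eigenspace T l = ⊥ := h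
  change Module.finrank ℂ (Module.End.eigenspace T l) = 0
  rw [h', finrank_bot]

/-- With all degrees positive, `φ = D^(-1/2) x` turns `A φ = l D φ` into the eigenvalue equation of
the Hermitian matrix `D^(-1/2) A D^(-1/2)`, whose eigenspaces fill the whole space. -/
theorem card_eq_finsum_finrank_adjKer (hG : ∀ v, 0 < G.degree v) :
    Fintype.card V = ∑ᶠ l : ℂ, Module.finrank ℂ (adjKer G l) := by
  let r : V → ℝ := fun v => Real.sqrt (G.degree v)
  have hr : ∀ v, (r v : ℂ) * r v = G.degree v := fun v => by
    rw [← Complex.ofReal_mul, Real.mul_self_sqrt (Nat.cast_nonneg _), Complex.ofReal_natCast]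
  have hr0 : ∀ v, (r v : ℂ) ≠ 0 := fun v => by
    have : 0 < r v := Real.sqrt_pos.2 (Nat.cast_pos.2 (hG v))
    exact_mod_cast this.ne'
  let N : Matrix V V ℂ := Matrix.of fun u v => (r u : ℂ)⁻¹ * G.adjMatrix ℂ u v * (r v : ℂ)⁻¹
  have hNe : ∀ u v, N u v = (r u : ℂ)⁻¹ * G.adjMatrix ℂ u v * (r v : ℂ)⁻¹ := fun _ _ => rfl
  have hN : N.IsHermitian := by
    ext u v
    simp only [N, Matrix.conjTranspose_apply, Matrix.of_apply, star_mul', star_inv₀,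
      SimpleGraph.adjMatrix_apply, G.adj_comm v u, apply_ite star, star_one, star_zero,
      Complex.star_def, Complex.conj_ofReal]
    ring
  have hsym := Matrix.isSymmetric_toEuclideanLin_iff.2 hN
  have h := finrank_eq_finsum_eigenspace hsym
  rw [finrank_euclideanSpace] at h
  rw [h]
  refine finsum_congr fun l => ?_
  let Φ : EuclideanSpace ℂ V →ₗ[ℂ] (V → ℂ) :=
    { toFun := fun x v => (r v : ℂ)⁻¹ * x v
      map_add' := fun x y => by
        funext v
        simp [mul_add]
      map_smul' := fun a x => by
        funext v
        simp [mul_left_comm] }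
  have hΦ : ∀ x v, Φ x v = (r v : ℂ)⁻¹ * x v := fun _ _ => rfl
  have key : ∀ x, x ∈ Module.End.eigenspace N.toEuclideanLin l ↔ Φ x ∈ adjKer G l := by
    intro x
    rw [Module.End.mem_eigenspace_iff, mem_adjKer]
    have h1 : ∀ v, N.toEuclideanLin x v = (r v : ℂ)⁻¹ * ∑ w ∈ G.neighborFinset v, Φ x w := by
      intro v
      rw [← SimpleGraph.adjMatrix_mulVec_apply]
      simp only [Matrix.toLpLin_apply, Matrix.mulVec, dotProduct, Finset.mul_sum]
      refine Finset.sum_congr rfl fun w _ => ?_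
      rw [hΦ, hNe]
      ring
    have h2 : ∀ v, G.degree v * Φ x v = r v * x v := fun v => by
      rw [← hr, hΦ]
      field_simp [hr0 v]
    simp only [h2, PiLp.ext_iff, h1, PiLp.smul_apply, smul_eq_mul]
    refine forall_congr' fun v => ?_
    rw [inv_mul_eq_iff_eq_mul₀ (hr0 v), mul_left_comm]
  refine finrank_eq_of_injOn_of_image Φ ?_ fun φ => ?_
  · intro x _ hx
    ext v
    have := congrFun hx v
    rw [hΦ] at this
    simpa [hr0] using this
  · have hs : Φ (WithLp.toLp 2 fun v => r v * φ v) = φ := funext fun v => by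
      rw [hΦ]
      exact inv_mul_cancel_left₀ (hr0 v) _
    constructor
    · intro hφ
      exact ⟨_, (key _).2 (by rwa [hs]), hs⟩
    · rintro ⟨x, hx, rfl⟩
      exact (key x).1 hx

end Graph

/-! ### Multiplicity formulas -/

section Multiplicities

variable {V : Type*} [Fintype V] [DecidableEq V] {G : SimpleGraph V} [DecidableRel G.Adj]

theorem cosSol_eq_one_or_of_sinSol_eq_zero {ω : ℂ} (h : sinSol ω 1 = 0) :
    cosSol ω 1 = 1 ∨ cosSol ω 1 = -1 := by
  have := cosSol_sq_add ω 1
  rw [h] at this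
  exact mul_self_eq_one_iff.1 (by rw [← sq]; simpa using this)

theorem multCK_of_ne_zero (O : Orientation G) (hG : ∀ v, 0 < G.degree v) {ω : ℂ}
    (hω : sinSol ω 1 ≠ 0) :
    multNeg (laplacianCK O) (ω ^ 2) = Module.finrank ℂ (adjKer G (cosSol ω 1)) := by
  rw [multNeg_laplacianCK O hG]
  exact finrank_spaceCK_of_ne_zero O (by linear_combination cosSol_sq_add ω 1) hω

theorem multCK_of_eq_zero (O : Orientation G) (hG : ∀ v, 0 < G.degree v) {ω : ℂ}
    (hω : sinSol ω 1 = 0) :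
    multNeg (laplacianCK O) (ω ^ 2) + Fintype.card V =
      G.edgeFinset.card + 2 * Module.finrank ℂ (adjKer G (cosSol ω 1)) := by
  rw [multNeg_laplacianCK O hG, hω, mul_zero]
  exact finrank_spaceCK_of_eq_zero O (cosSol_eq_one_or_of_sinSol_eq_zero hω)

theorem multKC_of_ne_zero (O : Orientation G) (hG : ∀ v, 0 < G.degree v) {ω : ℂ}
    (h0 : ω ≠ 0) (hω : sinSol ω 1 ≠ 0) :
    multNeg (laplacianKC O) (ω ^ 2) = Module.finrank ℂ (adjKer G (-cosSol ω 1)) := by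
  rw [multNeg_laplacianKC O hG]
  refine finrank_spaceCK_of_ne_zero O (by linear_combination cosSol_sq_add ω 1) ?_
  simp [h0, hω]

theorem multKC_of_eq_zero (O : Orientation G) (hG : ∀ v, 0 < G.degree v) {ω : ℂ}
    (hω : sinSol ω 1 = 0) :
    multNeg (laplacianKC O) (ω ^ 2) + Fintype.card V =
      G.edgeFinset.card + 2 * Module.finrank ℂ (adjKer G (-cosSol ω 1)) := by
  rw [multNeg_laplacianKC O hG, hω, mul_zero, spaceKC, neg_zero]
  refine finrank_spaceCK_of_eq_zero O ?_
  rcases cosSol_eq_one_or_of_sinSol_eq_zero hω with h | h <;> simp [h]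

/-- At `ω = 0` the sine solution is `x`, so its value at `1` is nonzero while `ω²` times it
vanishes. The parameters of `spaceKC` are then `(-1, 0, -1)`: the vertex function drops out and only
one copy of `adjKer G (-1)` is counted. -/
theorem multKC_zero (O : Orientation G) (hG : ∀ v, 0 < G.degree v) :
    multNeg (laplacianKC O) (0 ^ 2) + Fintype.card V =
      G.edgeFinset.card + Module.finrank ℂ (adjKer G (-1)) := by
  have h1 : cosSol 0 1 = 1 := by simp [cosSol]
  have h2 : sinSol 0 1 = 1 := by simp [sinSol]
  rw [multNeg_laplacianKC O hG, h1, h2, spaceKC, zero_pow two_ne_zero, zero_mul, neg_zero]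
  exact finrank_spaceCK_of_slope_eq_zero O hG (Or.inr rfl) (by simp)

/-- The complex cosine is surjective, and `sin ω = 0` would force `cos ω = ±1`. Hence every `l ≠
±1`, real or not, is seen by a nonexceptional eigenvalue parameter. -/
theorem exists_cosSol_eq {l : ℂ} (h1 : l ≠ 1) (h2 : l ≠ -1) :
    ∃ ω, ω ≠ 0 ∧ sinSol ω 1 ≠ 0 ∧ cosSol ω 1 = l := by
  obtain ⟨ω, rfl⟩ := Complex.cos_surjective l
  refine ⟨ω, ?_, fun h => ?_, by simp [cosSol]⟩
  · rintro rfl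
    simp at h1
  · have hc : cosSol ω 1 = Complex.cos ω := by simp [cosSol]
    rcases cosSol_eq_one_or_of_sinSol_eq_zero h with h | h
    · exact h1 (hc ▸ h)
    · exact h2 (hc ▸ h)

theorem sinSol_pi : sinSol Real.pi 1 = 0 := by simp [sinSol]

theorem cosSol_pi : cosSol Real.pi 1 = -1 := by simp [cosSol]

theorem sinSol_two_pi : sinSol (2 * Real.pi) 1 = 0 := by simp [sinSol]

theorem cosSol_two_pi : cosSol (2 * Real.pi) 1 = 1 := by simp [cosSol]

end Multiplicities

theorem numComp_eq_add {V : Type*} [Finite V] (G : SimpleGraph V) :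
    numComp G = numBipComp G + numNonBipComp G := by
  classical
  have := Fintype.ofFinite G.ConnectedComponent
  rw [numComp, numBipComp, numNonBipComp, ← Nat.card_sum]
  exact Nat.card_congr (Equiv.sumCompl _).symm

theorem isBipartite_iff_numNonBipComp_eq_zero {V : Type*} [Finite V] (G : SimpleGraph V) :
    G.IsBipartite ↔ numNonBipComp G = 0 := by
  rw [numNonBipComp, Finite.card_eq_zero_iff, isEmpty_subtype]
  simp only [not_not]
  exact SimpleGraph.colorable_iff_forall_connectedComponent

/-! ### Comparing the spectra of two graphs -/

section Pairs

variable {V₁ V₂ : Type*} [Fintype V₁] [DecidableEq V₁] [Fintype V₂] [DecidableEq V₂]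
  {G₁ : SimpleGraph V₁} {G₂ : SimpleGraph V₂} [DecidableRel G₁.Adj] [DecidableRel G₂.Adj]

theorem isospectral_of_finrank_adjKer_eq (O₁ : Orientation G₁) (O₂ : Orientation G₂)
    (hG₁ : ∀ v, 0 < G₁.degree v) (hG₂ : ∀ v, 0 < G₂.degree v)
    (hV : Fintype.card V₁ = Fintype.card V₂) (hE : G₁.edgeFinset.card = G₂.edgeFinset.card)
    (hk : ∀ l, Module.finrank ℂ (adjKer G₁ l) = Module.finrank ℂ (adjKer G₂ l)) :
    Isospectral (laplacianCK O₁) (laplacianCK O₂) ∧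
      Isospectral (laplacianKC O₁) (laplacianKC O₂) := by
  refine ⟨fun μ => ?_, fun μ => ?_⟩
  -- Every complex number is a square, so the formulas in `ω²` cover all eigenvalue candidates.
  · obtain ⟨ω, rfl⟩ := IsAlgClosed.exists_pow_nat_eq μ two_pos
    by_cases hS : sinSol ω 1 = 0
    · have h1 := multCK_of_eq_zero O₁ hG₁ hS
      have h2 := multCK_of_eq_zero O₂ hG₂ hS
      rw [hk] at h1
      omega
    · rw [multCK_of_ne_zero O₁ hG₁ hS, multCK_of_ne_zero O₂ hG₂ hS, hk]
  · obtain ⟨ω, rfl⟩ := IsAlgClosed.exists_pow_nat_eq μ two_pos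
    by_cases hS : sinSol ω 1 = 0
    · have h1 := multKC_of_eq_zero O₁ hG₁ hS
      have h2 := multKC_of_eq_zero O₂ hG₂ hS
      rw [hk] at h1
      omega
    · by_cases h0 : ω = 0
      · subst h0
        have h1 := multKC_zero O₁ hG₁
        have h2 := multKC_zero O₂ hG₂
        rw [hk] at h1
        omega
      · rw [multKC_of_ne_zero O₁ hG₁ h0 hS, multKC_of_ne_zero O₂ hG₂ h0 hS, hk]

/-- The multiplicities at `0`, `(2π)²` and `π²` are `c`, `N - n + 2c` and `N - n + 2c⁺`, which yield
`c`, `N - n` and `c⁺`. The remaining ones give `dim adjKer G l` for `l ≠ ±1`, and the sum over `l`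
is `n`. -/
theorem card_eq_and_numComp_eq_of_isospectralCK (O₁ : Orientation G₁) (O₂ : Orientation G₂)
    (hG₁ : ∀ v, 0 < G₁.degree v) (hG₂ : ∀ v, 0 < G₂.degree v)
    (h : Isospectral (laplacianCK O₁) (laplacianCK O₂)) :
    Fintype.card V₁ = Fintype.card V₂ ∧ G₁.edgeFinset.card = G₂.edgeFinset.card ∧
      numComp G₁ = numComp G₂ ∧ numBipComp G₁ = numBipComp G₂ := by
  have h0 : numComp G₁ = numComp G₂ := by
    have hS : sinSol 0 1 ≠ 0 := by simp [sinSol]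
    have hC : cosSol 0 1 = 1 := by simp [cosSol]
    have := h (0 ^ 2)
    rwa [multCK_of_ne_zero O₁ hG₁ hS, multCK_of_ne_zero O₂ hG₂ hS, hC, finrank_adjKer_one,
      finrank_adjKer_one] at this
  have a1 := multCK_of_eq_zero O₁ hG₁ sinSol_two_pi
  have a2 := multCK_of_eq_zero O₂ hG₂ sinSol_two_pi
  have b1 := multCK_of_eq_zero O₁ hG₁ sinSol_pi
  have b2 := multCK_of_eq_zero O₂ hG₂ sinSol_pi
  rw [h, cosSol_two_pi, finrank_adjKer_one] at a1
  rw [h, cosSol_pi, finrank_adjKer_neg_one] at b1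
  rw [cosSol_two_pi, finrank_adjKer_one] at a2
  rw [cosSol_pi, finrank_adjKer_neg_one] at b2
  have hb : numBipComp G₁ = numBipComp G₂ := by omega
  have hV : Fintype.card V₁ = Fintype.card V₂ := by
    rw [card_eq_finsum_finrank_adjKer hG₁, card_eq_finsum_finrank_adjKer hG₂]
    refine finsum_congr fun l => ?_
    by_cases h1 : l = 1
    · rw [h1, finrank_adjKer_one, finrank_adjKer_one, h0]
    by_cases h2 : l = -1
    · rw [h2, finrank_adjKer_neg_one, finrank_adjKer_neg_one, hb]
    obtain ⟨ω, -, hS, rfl⟩ := exists_cosSol_eq h1 h2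
    rw [← multCK_of_ne_zero O₁ hG₁ hS, ← multCK_of_ne_zero O₂ hG₂ hS, h]
  exact ⟨hV, by omega, h0, hb⟩

/-- Here the multiplicities at `0`, `(2π)²` and `π²` are `N - n + c⁺`, `N - n + 2c⁺` and `N - n +
2c`. The first two already separate `c⁺` from `N - n`, and the third gives `c`. -/
theorem card_eq_and_numComp_eq_of_isospectralKC (O₁ : Orientation G₁) (O₂ : Orientation G₂)
    (hG₁ : ∀ v, 0 < G₁.degree v) (hG₂ : ∀ v, 0 < G₂.degree v)
    (h : Isospectral (laplacianKC O₁) (laplacianKC O₂)) :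
    Fintype.card V₁ = Fintype.card V₂ ∧ G₁.edgeFinset.card = G₂.edgeFinset.card ∧
      numComp G₁ = numComp G₂ ∧ numBipComp G₁ = numBipComp G₂ := by
  have c1 := multKC_zero O₁ hG₁
  have c2 := multKC_zero O₂ hG₂
  have a1 := multKC_of_eq_zero O₁ hG₁ sinSol_two_pi
  have a2 := multKC_of_eq_zero O₂ hG₂ sinSol_two_pi
  have b1 := multKC_of_eq_zero O₁ hG₁ sinSol_pi
  have b2 := multKC_of_eq_zero O₂ hG₂ sinSol_pi
  rw [h, finrank_adjKer_neg_one] at c1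
  rw [finrank_adjKer_neg_one] at c2
  rw [h, cosSol_two_pi, finrank_adjKer_neg_one] at a1
  rw [h, cosSol_pi, neg_neg, finrank_adjKer_one] at b1
  rw [cosSol_two_pi, finrank_adjKer_neg_one] at a2
  rw [cosSol_pi, neg_neg, finrank_adjKer_one] at b2
  have hb : numBipComp G₁ = numBipComp G₂ := by omega
  have h0 : numComp G₁ = numComp G₂ := by omega
  have hV : Fintype.card V₁ = Fintype.card V₂ := by
    rw [card_eq_finsum_finrank_adjKer hG₁, card_eq_finsum_finrank_adjKer hG₂]
    refine finsum_congr fun l => ?_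
    by_cases h1 : l = 1
    · rw [h1, finrank_adjKer_one, finrank_adjKer_one, h0]
    by_cases h2 : l = -1
    · rw [h2, finrank_adjKer_neg_one, finrank_adjKer_neg_one, hb]
    obtain ⟨ω, hω, hS, hl⟩ := exists_cosSol_eq (l := -l) (fun h => h2 (neg_eq_iff_eq_neg.1 h))
      (fun h => h1 (neg_inj.1 h))
    obtain rfl := neg_eq_iff_eq_neg.1 hl.symm
    rw [← multKC_of_ne_zero O₁ hG₁ hω hS, ← multKC_of_ne_zero O₂ hG₂ hω hS, h]
  exact ⟨hV, by omega, h0, hb⟩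

end Pairs

/-! ### Transplantation of eigenfunctions between two graphs -/

section Transplantation

variable {V₁ V₂ : Type*} [Fintype V₁] [DecidableEq V₁] [Fintype V₂] [DecidableEq V₂]
  {G₁ : SimpleGraph V₁} {G₂ : SimpleGraph V₂} [DecidableRel G₁.Adj] [DecidableRel G₂.Adj]

/-- The spaces `A φ = l D φ` as eigenspaces of a multiple `R` of the transition matrix. -/
theorem mem_adjKer_iff_mulVec_eq (hG : ∀ v, 0 < G₁.degree v) {R : Matrix V₁ V₁ ℤ} {k : ℤ}
    (hk : k ≠ 0) (hR : ∀ v w, (G₁.degree v : ℤ) * R v w = if G₁.Adj v w then k else 0) {l : ℂ}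
    {φ : V₁ → ℂ} :
    φ ∈ adjKer G₁ l ↔ (R.map (Int.castRingHom ℂ)).mulVec φ = (k * l) • φ := by
  rw [mem_adjKer, funext_iff]
  refine forall_congr' fun v => ?_
  have hd : (G₁.degree v : ℂ) ≠ 0 := Nat.cast_ne_zero.2 (hG v).ne'
  have hk' : (k : ℂ) ≠ 0 := Int.cast_ne_zero.2 hk
  have h : (G₁.degree v : ℂ) * (R.map (Int.castRingHom ℂ)).mulVec φ v =
      k * ∑ w ∈ G₁.neighborFinset v, φ w := by
    rw [← SimpleGraph.adjMatrix_mulVec_apply, Matrix.mulVec, Matrix.mulVec, dotProduct,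
      dotProduct, Finset.mul_sum, Finset.mul_sum]
    refine Finset.sum_congr rfl fun w _ => ?_
    have := congrArg (Int.cast : ℤ → ℂ) (hR v w)
    push_cast at this
    rw [Matrix.map_apply, eq_intCast, SimpleGraph.adjMatrix_apply, ← mul_assoc, this]
    split_ifs <;> simp
  rw [← mul_right_inj' hk', ← h, Pi.smul_apply, smul_eq_mul,
    ← mul_right_inj' hd (b := Matrix.mulVec _ _ _)]
  constructor <;> intro h' <;> linear_combination h'

theorem map_zsmul_one_mulVec {V : Type*} [Fintype V] [DecidableEq V] (m : ℤ) (φ : V → ℂ) :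
    ((m • (1 : Matrix V V ℤ)).map (Int.castRingHom ℂ)).mulVec φ = (m : ℂ) • φ := by
  funext v
  simp only [Matrix.mulVec, dotProduct, Matrix.map_apply, Matrix.smul_apply, Matrix.one_apply,
    smul_eq_mul, mul_ite, mul_one, mul_zero, eq_intCast, Pi.smul_apply]
  simp [apply_ite (Int.cast : ℤ → ℂ)]

/-- The matrix `T` carries eigenvectors of `R₁` to eigenvectors of `R₂` with the same eigenvalue,
and `T' / m` is its inverse. The factors `k` and `m` clear denominators, so that the hypotheses are
identities of integer matrices. -/
theorem finrank_adjKer_eq_of_transplantation (hG₁ : ∀ v, 0 < G₁.degree v)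
    (hG₂ : ∀ v, 0 < G₂.degree v) {R₁ : Matrix V₁ V₁ ℤ} {R₂ : Matrix V₂ V₂ ℤ} {k m : ℤ}
    (hk : k ≠ 0) (hm : m ≠ 0)
    (hR₁ : ∀ v w, (G₁.degree v : ℤ) * R₁ v w = if G₁.Adj v w then k else 0)
    (hR₂ : ∀ v w, (G₂.degree v : ℤ) * R₂ v w = if G₂.Adj v w then k else 0)
    {T : Matrix V₂ V₁ ℤ} {T' : Matrix V₁ V₂ ℤ} (h1 : R₂ * T = T * R₁) (h2 : R₁ * T' = T' * R₂)
    (h3 : T * T' = m • (1 : Matrix V₂ V₂ ℤ)) (h4 : T' * T = m • (1 : Matrix V₁ V₁ ℤ)) (l : ℂ) :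
    Module.finrank ℂ (adjKer G₁ l) = Module.finrank ℂ (adjKer G₂ l) := by
  have hm' : (m : ℂ) ≠ 0 := Int.cast_ne_zero.2 hm
  have e1 := congrArg (fun X => X.map (Int.castRingHom ℂ)) h1
  have e2 := congrArg (fun X => X.map (Int.castRingHom ℂ)) h2
  have e3 := congrArg (fun X => X.map (Int.castRingHom ℂ)) h3
  have e4 := congrArg (fun X => X.map (Int.castRingHom ℂ)) h4
  simp only [Matrix.map_mul] at e1 e2 e3 e4
  refine finrank_eq_of_injOn_of_image (T.map (Int.castRingHom ℂ)).mulVecLin ?_ fun φ => ?_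
  · intro φ _ hφ
    have : (m : ℂ) • φ = 0 := by
      rw [← map_zsmul_one_mulVec, ← e4, ← Matrix.mulVec_mulVec]
      rw [Matrix.mulVecLin_apply] at hφ
      rw [hφ, Matrix.mulVec_zero]
    exact (smul_eq_zero.1 this).resolve_left hm'
  · simp only [mem_adjKer_iff_mulVec_eq hG₁ hk hR₁, mem_adjKer_iff_mulVec_eq hG₂ hk hR₂,
      Matrix.mulVecLin_apply]
    constructor
    · intro hφ
      refine ⟨(m : ℂ)⁻¹ • (T'.map (Int.castRingHom ℂ)).mulVec φ, ?_, ?_⟩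
      · rw [Matrix.mulVec_smul, Matrix.mulVec_mulVec, e2, ← Matrix.mulVec_mulVec, hφ,
          Matrix.mulVec_smul, smul_comm]
      · rw [Matrix.mulVec_smul, Matrix.mulVec_mulVec, e3, map_zsmul_one_mulVec,
          inv_smul_smul₀ hm']
    · rintro ⟨ψ, hψ, rfl⟩
      rw [Matrix.mulVec_mulVec, e1, ← Matrix.mulVec_mulVec, hψ, Matrix.mulVec_smul]

end Transplantation

theorem finrank_adjKer_cycleGraph_eight (l : ℂ) :
    Module.finrank ℂ (adjKer (SimpleGraph.cycleGraph 8) l) =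
      Module.finrank ℂ (adjKer squareWithTwoPaths l) := by
  -- `R₁` and `R₂` are `4 D⁻¹A`, where `4` is the least common multiple of the degrees `1, 2, 4`.
  -- `T` is an explicit intertwiner with inverse `T' / 4`; all identities are finite computations.
  refine finrank_adjKer_eq_of_transplantation (k := 4) (m := 4)
    (R₁ := !![0, 2, 0, 0, 0, 0, 0, 2; 2, 0, 2, 0, 0, 0, 0, 0; 0, 2, 0, 2, 0, 0, 0, 0;
      0, 0, 2, 0, 2, 0, 0, 0; 0, 0, 0, 2, 0, 2, 0, 0; 0, 0, 0, 0, 2, 0, 2, 0;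
      0, 0, 0, 0, 0, 2, 0, 2; 2, 0, 0, 0, 0, 0, 2, 0])
    (R₂ := !![0, 1, 0, 1, 1, 0, 1, 0; 2, 0, 2, 0, 0, 0, 0, 0; 0, 2, 0, 2, 0, 0, 0, 0;
      2, 0, 2, 0, 0, 0, 0, 0; 2, 0, 0, 0, 0, 2, 0, 0; 0, 0, 0, 0, 4, 0, 0, 0;
      2, 0, 0, 0, 0, 0, 0, 2; 0, 0, 0, 0, 0, 0, 4, 0])
    (T := !![0, 0, -1, 0, 0, 0, -1, 0; 0, 1, 0, -1, 0, -1, 0, -1; 0, 0, 1, 0, -2, 0, -1, 0;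
      0, 0, 0, 0, 0, -2, 0, 0; 0, -2, 0, -1, 0, 1, 0, 0; -2, 0, -2, 0, 0, 0, 2, 0;
      0, -1, 0, 0, 0, 0, 0, -1; -2, 0, 0, 0, 0, 0, 0, 0])
    (T' := !![0, 0, 0, 0, 0, 0, 0, -2; 0, 1, 0, -1, -1, 0, -1, 0; -2, 0, 0, 0, 0, -1, 0, 1;
      0, -2, 0, 0, -2, 0, 2, 0; 0, 0, -2, 0, 0, -1, 0, 1; 0, 0, 0, -2, 0, 0, 0, 0;
      -2, 0, 0, 0, 0, 1, 0, -1; 0, -1, 0, 1, 1, 0, -3, 0])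
    ?_ ?_ (by norm_num) (by norm_num) ?_ ?_ ?_ ?_ ?_ ?_ l
  all_goals decide +kernel

/-! ### Counting spanning trees -/

section SpanningTrees

/-- In a graph with as many edges as vertices, a spanning tree arises by deleting an edge. -/
theorem complexity_eq_card_connected_deleteEdges {V : Type*} [Fintype V] [DecidableEq V]
    (G : SimpleGraph V) [DecidableRel G.Adj] (hE : G.edgeFinset.card = Fintype.card V) :
    complexity G = Nat.card {e : Sym2 V // e ∈ G.edgeSet ∧ (G.deleteEdges {e}).Connected} := by
  classical
  have hcard : ∀ T : SimpleGraph V, T.IsTree ↔ T.Connected ∧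
      T.edgeFinset.card + 1 = Fintype.card V := by
    intro T
    rw [SimpleGraph.isTree_iff_connected_and_card, Nat.card_eq_fintype_card,
      Nat.card_eq_fintype_card, SimpleGraph.edgeFinset_card]
  have hdel : ∀ e ∈ G.edgeSet, (G.deleteEdges {e}).edgeFinset.card + 1 = Fintype.card V := by
    intro e he
    have : (G.deleteEdges {e}).edgeFinset = G.edgeFinset.erase e := by
      ext f
      simp [and_comm]
    rw [this, Finset.card_erase_add_one (SimpleGraph.mem_edgeFinset.2 he), hE]
  symm
  refine Nat.card_congr (Equiv.ofBijective (fun e => ⟨G.deleteEdges {e.1},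
    SimpleGraph.deleteEdges_le _, (hcard _).2 ⟨e.2.2, by convert hdel _ e.2.1⟩⟩) ⟨?_, ?_⟩)
  · rintro ⟨e, he, _⟩ ⟨f, hf, _⟩ h
    have h' := congrArg SimpleGraph.edgeSet (congrArg Subtype.val h)
    simp only [SimpleGraph.edgeSet_deleteEdges] at h'
    by_contra hne
    have hne' : e ≠ f := fun h => hne (Subtype.ext h)
    have : e ∈ G.edgeSet \ {f} := ⟨he, hne'⟩
    rw [← h'] at this
    exact this.2 rfl
  · rintro ⟨T, hle, hT⟩
    obtain ⟨hc, hn⟩ := (hcard T).1 hT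
    have hsub : T.edgeFinset ⊆ G.edgeFinset := SimpleGraph.edgeFinset_mono hle
    -- A spanning tree has one edge fewer than there are vertices, so it misses exactly one edge of
    -- `G`.
    have h1 : (G.edgeFinset \ T.edgeFinset).card = 1 := by
      rw [Finset.card_sdiff_of_subset hsub]
      omega
    obtain ⟨e, he⟩ := Finset.card_eq_one.1 h1
    have heG : e ∈ G.edgeSet := by
      have : e ∈ G.edgeFinset \ T.edgeFinset := he ▸ Finset.mem_singleton_self e
      exact SimpleGraph.mem_edgeFinset.1 (Finset.mem_sdiff.1 this).1
    have hTe : G.deleteEdges {e} = T := by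
      rw [← SimpleGraph.edgeFinset_inj, ← Finset.sdiff_sdiff_eq_self hsub, he]
      ext f
      simp
    exact ⟨⟨e, heG, hTe ▸ hc⟩, Subtype.ext hTe⟩

/-- Following parents decreases the rank, so it ends at the root. A parent map with ranks is a
certificate of connectedness checkable by finite computation. -/
theorem connected_of_parent {V : Type*} {G : SimpleGraph V} (root : V) (p : V → V)
    (rank : V → ℕ) (h : ∀ v, v ≠ root → G.Adj v (p v) ∧ rank (p v) < rank v) : G.Connected := by
  have key : ∀ n v, rank v = n → G.Reachable v root := by
    intro n
    induction n using Nat.strong_induction_on with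
    | _ n ih =>
      rintro v rfl
      by_cases hv : v = root
      · rw [hv]
      · obtain ⟨h1, h2⟩ := h v hv
        exact h1.reachable.trans (ih _ h2 _ rfl)
  exact SimpleGraph.connected_iff_exists_forall_reachable _ |>.2
    ⟨root, fun v => (key _ v rfl).symm⟩

theorem not_connected_of_closed {V : Type*} {G : SimpleGraph V} (S : Set V) {x y : V}
    (hx : x ∈ S) (hy : y ∉ S) (h : ∀ u v, G.Adj u v → u ∈ S → v ∈ S) : ¬ G.Connected := by
  intro hc
  obtain ⟨w⟩ := hc.preconnected x y
  induction w with
  | nil => exact hy hx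
  | cons hadj _ ih => exact ih (h _ _ hadj hx) hy

theorem complexity_cycleGraph_eight : complexity (SimpleGraph.cycleGraph 8) = 8 := by
  have hE : (SimpleGraph.cycleGraph 8).edgeFinset.card = 8 := by decide +kernel
  rw [complexity_eq_card_connected_deleteEdges _ hE]
  have hedge : ∀ e ∈ (SimpleGraph.cycleGraph 8).edgeFinset, ∃ i : Fin 8, e = s(i, i + 1) := by
    decide +kernel
  -- With the edge from `i` to `i + 1` deleted, walking forward from any vertex reaches `i` without
  -- using that edge; the rank `i - v` is the number of steps left.
  have hadj : ∀ i v : Fin 8, v ≠ i → (SimpleGraph.cycleGraph 8).Adj v (v + 1) ∧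
      s(v, v + 1) ≠ s(i, i + 1) ∧ (i - (v + 1)).val < (i - v).val := by
    decide +kernel
  have hset : ∀ e, e ∈ (SimpleGraph.cycleGraph 8).edgeSet ∧
      ((SimpleGraph.cycleGraph 8).deleteEdges {e}).Connected ↔
      e ∈ (SimpleGraph.cycleGraph 8).edgeFinset := by
    intro e
    rw [SimpleGraph.mem_edgeFinset, and_iff_left_iff_imp]
    intro he
    obtain ⟨i, rfl⟩ := hedge e (SimpleGraph.mem_edgeFinset.2 he)
    refine connected_of_parent i (· + 1) (fun v => (i - v).val) fun v hv => ?_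
    obtain ⟨h1, h2, h3⟩ := hadj i v hv
    exact ⟨SimpleGraph.deleteEdges_adj.2 ⟨h1, h2⟩, h3⟩
  rw [Nat.card_congr (Equiv.subtypeEquivRight hset), Nat.card_eq_fintype_card, Fintype.card_coe,
    hE]

theorem complexity_squareWithTwoPaths : complexity squareWithTwoPaths = 4 := by
  have hE : squareWithTwoPaths.edgeFinset.card = 8 := by decide +kernel
  rw [complexity_eq_card_connected_deleteEdges _ hE]
  have hedge : ∀ e, e ∈ squareWithTwoPaths.edgeSet ↔ e ∈ ({s(0, 1), s(1, 2), s(2, 3), s(3, 0),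
      s(0, 4), s(4, 5), s(0, 6), s(6, 7)} : Finset (Sym2 (Fin 8))) := by
    rintro ⟨a, b⟩
    rfl
  have conn : ∀ (e : Sym2 (Fin 8)) (p : Fin 8 → Fin 8) (rank : Fin 8 → ℕ),
      (∀ v, v ≠ 0 → (squareWithTwoPaths.Adj v (p v) ∧ s(v, p v) ≠ e) ∧ rank (p v) < rank v) →
      (squareWithTwoPaths.deleteEdges {e}).Connected := fun e p rank h =>
    connected_of_parent 0 p rank fun v hv => ⟨SimpleGraph.deleteEdges_adj.2 (h v hv).1,
      (h v hv).2⟩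
  have disc : ∀ (e : Sym2 (Fin 8)) (S : Finset (Fin 8)) (x : Fin 8), x ∈ S → 0 ∉ S →
      (∀ u v, squareWithTwoPaths.Adj u v → s(u, v) ≠ e → u ∈ S → v ∈ S) →
      ¬ (squareWithTwoPaths.deleteEdges {e}).Connected := fun e S x hx h0 h =>
    not_connected_of_closed (S : Set (Fin 8)) (Finset.mem_coe.2 hx) (mt Finset.mem_coe.1 h0)
      fun u v huv => h u v (SimpleGraph.deleteEdges_adj.1 huv).1
        (SimpleGraph.deleteEdges_adj.1 huv).2
  have hset : ∀ e, e ∈ squareWithTwoPaths.edgeSet ∧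
      (squareWithTwoPaths.deleteEdges {e}).Connected ↔
      e ∈ ({s(0, 1), s(1, 2), s(2, 3), s(3, 0)} : Finset (Sym2 (Fin 8))) := by
    intro e
    rw [hedge]
    simp only [Finset.mem_insert, Finset.mem_singleton]
    constructor
    · rintro ⟨he, hc⟩
      -- The first four edges form the circuit. The other four are bridges, and the set given to
      -- `disc` is the part of a path that is cut off from the vertex `0`.
      rcases he with h | h | h | h | rfl | rfl | rfl | rfl
      · exact Or.inl h
      · exact Or.inr (Or.inl h)
      · exact Or.inr (Or.inr (Or.inl h))
      · exact Or.inr (Or.inr (Or.inr h))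
      · exact absurd hc (disc _ {4, 5} 4 (by decide) (by decide) (by decide +kernel))
      · exact absurd hc (disc _ {5} 5 (by decide) (by decide) (by decide +kernel))
      · exact absurd hc (disc _ {6, 7} 6 (by decide) (by decide) (by decide +kernel))
      · exact absurd hc (disc _ {7} 7 (by decide) (by decide) (by decide +kernel))
    · rintro (rfl | rfl | rfl | rfl)
      -- The two vectors list the parents and the depths in the spanning tree rooted at `0` that
      -- remains after deleting the circuit edge.
      · exact ⟨by simp, conn _ ![0, 2, 3, 0, 0, 4, 0, 6] ![0, 3, 2, 1, 1, 2, 1, 2]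
          (by decide +kernel)⟩
      · exact ⟨by simp, conn _ ![0, 0, 3, 0, 0, 4, 0, 6] ![0, 1, 2, 1, 1, 2, 1, 2]
          (by decide +kernel)⟩
      · exact ⟨by simp, conn _ ![0, 0, 1, 0, 0, 4, 0, 6] ![0, 1, 2, 1, 1, 2, 1, 2]
          (by decide +kernel)⟩
      · exact ⟨by simp, conn _ ![0, 0, 1, 2, 0, 4, 0, 6] ![0, 1, 2, 3, 1, 2, 1, 2]
          (by decide +kernel)⟩
  rw [Nat.card_congr (Equiv.subtypeEquivRight hset), Nat.card_eq_fintype_card, Fintype.card_coe]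
  decide +kernel

end SpanningTrees

end

end QGraph

/-! ### The theorem -/

theorem theorem5p5 :
    -- what the spectrum of either Laplacian determines
    (∀ {V₁ V₂ : Type*} [Fintype V₁] [DecidableEq V₁] [Fintype V₂] [DecidableEq V₂]
      (G₁ : SimpleGraph V₁) (G₂ : SimpleGraph V₂) [DecidableRel G₁.Adj] [DecidableRel G₂.Adj]
      (O₁ : QGraph.Orientation G₁) (O₂ : QGraph.Orientation G₂),
      (∀ v, 0 < G₁.degree v) → (∀ v, 0 < G₂.degree v) →
      (QGraph.Isospectral (QGraph.laplacianCK O₁) (QGraph.laplacianCK O₂) ∨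
        QGraph.Isospectral (QGraph.laplacianKC O₁) (QGraph.laplacianKC O₂)) →
      Fintype.card V₁ = Fintype.card V₂ ∧
      G₁.edgeFinset.card = G₂.edgeFinset.card ∧
      QGraph.numComp G₁ = QGraph.numComp G₂ ∧
      QGraph.numBipComp G₁ = QGraph.numBipComp G₂ ∧
      QGraph.numNonBipComp G₁ = QGraph.numNonBipComp G₂ ∧
      (G₁.IsBipartite ↔ G₂.IsBipartite)) ∧
    -- what it does not determine
    ((∀ v, 0 < (SimpleGraph.cycleGraph 8).degree v) ∧
      (∀ v, 0 < QGraph.squareWithTwoPaths.degree v) ∧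
      (∀ (O₁ : QGraph.Orientation (SimpleGraph.cycleGraph 8))
        (O₂ : QGraph.Orientation QGraph.squareWithTwoPaths),
        QGraph.Isospectral (QGraph.laplacianCK O₁) (QGraph.laplacianCK O₂) ∧
        QGraph.Isospectral (QGraph.laplacianKC O₁) (QGraph.laplacianKC O₂)) ∧
      QGraph.degrees (SimpleGraph.cycleGraph 8) ≠ QGraph.degrees QGraph.squareWithTwoPaths ∧
      (∃ d, (SimpleGraph.cycleGraph 8).IsRegularOfDegree d) ∧
      (¬ ∃ d, QGraph.squareWithTwoPaths.IsRegularOfDegree d) ∧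
      QGraph.complexity (SimpleGraph.cycleGraph 8) = 8 ∧
      QGraph.complexity QGraph.squareWithTwoPaths = 4) := by
  refine ⟨?_, by decide +kernel, by decide +kernel, ?_, by decide +kernel,
    ⟨2, by unfold SimpleGraph.IsRegularOfDegree; decide +kernel⟩, ?_,
    QGraph.complexity_cycleGraph_eight, QGraph.complexity_squareWithTwoPaths⟩
  · intro V₁ V₂ _ _ _ _ G₁ G₂ _ _ O₁ O₂ hG₁ hG₂ h
    obtain ⟨hV, hE, hc, hb⟩ := h.elim
      (QGraph.card_eq_and_numComp_eq_of_isospectralCK O₁ O₂ hG₁ hG₂)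
      (QGraph.card_eq_and_numComp_eq_of_isospectralKC O₁ O₂ hG₁ hG₂)
    have h1 := QGraph.numComp_eq_add G₁
    have h2 := QGraph.numComp_eq_add G₂
    have hn : QGraph.numNonBipComp G₁ = QGraph.numNonBipComp G₂ := by omega
    refine ⟨hV, hE, hc, hb, hn, ?_⟩
    rw [QGraph.isBipartite_iff_numNonBipComp_eq_zero, QGraph.isBipartite_iff_numNonBipComp_eq_zero,
      hn]
  · intro O₁ O₂
    exact QGraph.isospectral_of_finrank_adjKer_eq O₁ O₂ (by decide +kernel) (by decide +kernel) rfl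
      (by decide +kernel) QGraph.finrank_adjKer_cycleGraph_eight
  · rintro ⟨d, hd⟩
    have h5 : QGraph.squareWithTwoPaths.degree 5 = 1 := by decide +kernel
    have h1 : QGraph.squareWithTwoPaths.degree 1 = 2 := by decide +kernel
    have := (hd 5).trans (hd 1).symm
    omega
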